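/- **The model.** Fix $D,g\in\mathbb N$ and a threshold $\tau>0$. For a covariate vector $x\in\mathbb R^D$ and a parameter $\Phi=(\alpha,\beta,\phi,\theta,\nu)$ with $\alpha=(\alpha_1,\dots,\alpha_g)$ and $\beta=(\beta_1,\dots,\beta_g)$ in $\mathbb R^{D\times g}$, $\phi\in(0,\infty)^g$, $\theta>0$, $\nu\in\mathbb R^D$ (and $\alpha_{g+1}:=0$), put $$h_Y(y;\Phi,x)=\sum_{j=1}^g\pi_j(x;\alpha)\frac{f(y;e^{\beta_j^Tx},\phi_j)}{F(\tau;e^{\beta_j^Tx},\phi_j)}1\{y\le\tau\}+\pi_{g+1}(x;\alpha)\frac{h(y;\theta,e^{\nu^Tx})}{1-H(\tau;\theta,e^{\nu^Tx})}1\{y>\tau\},$$ where $\pi_j(x;\alpha)=e^{\alpha_j^Tx}/\sum_{j'=1}^{g+1}e^{\alpha_{j'}^Tx}$, $f(y;\mu,\phi)=\frac{(\phi\mu)^{-1/\phi}}{\Gamma(1/\phi)}y^{1/\phi-1}e^{-y/(\phi\mu)}$ and $h(y;\theta,\eta)=\eta\theta^\eta/(y+\theta)^{\eta+1}$ for $y>0$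 (both are $0$ for $y\le 0$), with distribution functions $F$ and $H$. The covariates have a law $G$ on $\mathbb R^D$, and $h(v;\Phi)=h_Y(y;\Phi,x)$ is the density of $v=(y,x)$ with respect to Lebesgue measure $\otimes\,G$. The parameter space $\Omega$ is an open set of parameters, and $\Phi_0=(\alpha_0,\beta_0,\phi_0,\theta_0,\nu_0)\in\Omega$ is the true parameter. Write $\Phi=(\psi_1,\dots,\psi_Q)$ for the scalar (free) parameters and $\|\cdot\|_2$ for Euclidean norms. Let $V_i=(Y_i,x_i)$, $i\ge1$, be i.i.d. with density $h(\cdot;\Phi_0)$. **The objective.** For $l=1,2,3$ let $c_{l1},\dots,c_{lK_l}\in\mathbb R^D$ be fixed vectors, and put $N_{1k}(\Phi)=\|c_{1k}^T\alpha\|_2$, $N_{2k}(\Phi)=\|c_{2k}^T\beta\|_2$, $N_{3k}(\Phi)=|c_{3k}^T\nu|$. The penalized log-likelihood is $$\mathcal F_n(\Phi)=\sum_{i=1}^n\log h_Y(Y_i;\Phi,x_i)-\sum_{l=1}^3\sum_{k=1}^{K_l}p_{ln}(N_{lk}(\Phi);\lambda_{lkn}),$$ where the functions $p_{ln}(\cdot;\lambda_{lkn})$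 are concave on $[0,\infty)$, and $p_{ln}$ and $\lambda_{lkn}$ may depend on the data. Let $\psi_{lk}=N_{lk}(\Phi_0)$ and $\mathcal Z_l=\{k:\psi_{lk}=0\}$; primes denote derivatives in $\psi$. **Penalty conditions.** - **H1.** For all $l,k,n$: $p_{ln}(0;\lambda_{lkn})=0$, and $p_{ln}(\cdot;\lambda_{lkn})$ is non-decreasing on $[0,\infty)$ and twice differentiable on $(0,\infty)$ except in a finite set (which may depend on $l,k,n$ and the data). - **H2.** For all $l$, all $k\notin\mathcal Z_l$ and all $M,\varepsilon>0$, with probability tending to one $p_{ln}(\cdot;\lambda_{lkn})$ is twice differentiable with $|p''_{ln}(\psi;\lambda_{lkn})|/n\le\varepsilon$ at every $\psi$ with $|\psi-\psi_{lk}|\le Mn^{-1/2}$. - **H3.** For all $l$ and $k\in\mathcal Z_l$, the infimum of $p'_{ln}(\psi;\lambda_{lkn})/\sqrt n$ over $0<\psi\le n^{-1/2}\log n$ (where the derivative exists) tends to infinity in probability. - **H4.** For all $l$ and $k\notin\mathcal Z_l$, $p'_{ln}(\psi_{lk};\lambda_{lkn})/\sqrt n=O_P(1)$. **Regularity conditions.**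 - **R1.** The support of $h(\cdot;\Phi)$ is the same for all $\Phi\in\Omega$, and on $\Omega$ the density determines $\Phi$ up to a permutation of the $g$ body components. - **R2.** For almost all $v$, $h(v;\Phi)$ has all partial derivatives up to order three in $\Phi$ at every $\Phi\in\Omega$. - **R3.** For all $\Phi\in\Omega$ and all $j_1,j_2$, the following expectations under $h(\cdot;\Phi)$ exist and satisfy $E_\Phi[\partial_{\psi_{j_1}}\log h(v;\Phi)]=0$ and $E_\Phi[\partial_{\psi_{j_1}}\log h(v;\Phi)\,\partial_{\psi_{j_2}}\log h(v;\Phi)]=E_\Phi[-\partial_{\psi_{j_1}}\partial_{\psi_{j_2}}\log h(v;\Phi)]$. - **R4.** The Fisher information matrix $\mathcal I(\Phi_0)=E_{\Phi_0}[(\partial_\Phi\log h(v;\Phi_0))(\partial_\Phi\log h(v;\Phi_0))^T]$ is finite and positive definite. - **R5.** There are a function $\mathcal M$ with $E_{\Phi_0}[\mathcal M(v)]<\infty$ and a neighbourhood of $\Phi_0$ such that, for almost all $v$ and all $\Phi$ in the neighbourhood, all first, second and third partial derivatives of $\log h(v;\Phi)$ in $\Phi$ are at most $\mathcal M(v)$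 in absolute value. **Theorem.** Under H1–H4 and R1–R5 there is a sequence $\hat\Phi_n$ such that, with probability tending to one, $\hat\Phi_n\in\Omega$ is a local maximizer of $\mathcal F_n$, and $\|\hat\Phi_n-\Phi_0\|_2=O_P(n^{-1/2})$ as $n\to\infty$. -/

import Mathlib

open Filter Topology MeasureTheory ProbabilityTheory

noncomputable section

namespace CompositeReg

/-! ## The parameters -/

/-- Covariate vectors in `ℝ^D` with the Euclidean norm. -/
abbrev Cov (D : ℕ) : Type := EuclideanSpace ℝ (Fin D)

/-- An observation `v = (y, x)`. -/
abbrev Obs (D : ℕ) : Type := ℝ × Cov D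

/-- The index set of the free scalar parameters, in the order `α, β, φ, θ, ν`. The coefficient
`α_{g+1}` is fixed to be `0`, so that only `α_1, …, α_g` are free. -/
abbrev ParamIdx (D g : ℕ) : Type :=
  (Fin g × Fin D) ⊕ (Fin g × Fin D) ⊕ Fin g ⊕ Unit ⊕ Fin D

/-- The parameter vector `Φ = (α, β, φ, θ, ν)`, with the Euclidean norm. -/
abbrev Param (D g : ℕ) : Type := EuclideanSpace ℝ (ParamIdx D g)

variable {D g : ℕ}

/-- The vector `α_j ∈ ℝ^D`, for `j = 1, …, g`. -/
def Param.alpha (Φ : Param D g) (j : Fin g) : Cov D :=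
  WithLp.toLp 2 fun d => Φ (Sum.inl (j, d))

/-- The vector `β_j ∈ ℝ^D`, for `j = 1, …, g`. -/
def Param.beta (Φ : Param D g) (j : Fin g) : Cov D :=
  WithLp.toLp 2 fun d => Φ (Sum.inr (Sum.inl (j, d)))

/-- The dispersion `φ_j`, for `j = 1, …, g`. -/
def Param.phi (Φ : Param D g) (j : Fin g) : ℝ := Φ (Sum.inr (Sum.inr (Sum.inl j)))

/-- The Lomax scale `θ`. -/
def Param.theta (Φ : Param D g) : ℝ := Φ (Sum.inr (Sum.inr (Sum.inr (Sum.inl ()))))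

/-- The vector `ν ∈ ℝ^D`. -/
def Param.nu (Φ : Param D g) : Cov D :=
  WithLp.toLp 2 fun d => Φ (Sum.inr (Sum.inr (Sum.inr (Sum.inr d))))

/-- The parameters for which the model makes sense: all `φ_j` and `θ` are positive. -/
def naturalParams (D g : ℕ) : Set (Param D g) :=
  {Φ | (∀ j, 0 < Φ.phi j) ∧ 0 < Φ.theta}

/-! ## The model -/

/-- The Gamma density with mean `μ` and dispersion `φ`. -/
def gammaDens (μ φ y : ℝ) : ℝ :=
  if 0 < y then
    (φ * μ) ^ (-(1 / φ)) / Real.Gamma (1 / φ) * y ^ (1 / φ - 1) * Real.exp (-(y / (φ * μ)))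
  else 0

/-- The Lomax (Pareto type II) density with scale `θ` and tail index `η`. -/
def lomaxDens (θ η y : ℝ) : ℝ :=
  if 0 < y then η * θ ^ η / (y + θ) ^ (η + 1) else 0

/-- The distribution function of a density on the real line. -/
def cdfOf (f : ℝ → ℝ) (t : ℝ) : ℝ := ∫ y in Set.Iic t, f y

/-- `∑_{j ≤ g+1} exp(α_jᵀ x)`; the last term is `1`, because `α_{g+1} = 0`. -/
def weightDenom (Φ : Param D g) (x : Cov D) : ℝ :=
  (∑ j : Fin g, Real.exp (inner ℝ (Φ.alpha j) x)) + 1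

/-- The weight `π_j(x; α)` of a body component, `j = 1, …, g`. -/
def bodyWeight (Φ : Param D g) (x : Cov D) (j : Fin g) : ℝ :=
  Real.exp (inner ℝ (Φ.alpha j) x) / weightDenom Φ x

/-- The weight `π_{g+1}(x; α)` of the tail component. -/
def tailWeight (Φ : Param D g) (x : Cov D) : ℝ := 1 / weightDenom Φ x

/-- The density `h_Y(y; Φ, x)` of the mixture-Gamma/Lomax composite regression model with
threshold `τ`, as a function of `v = (y, x)`. -/
def dens (τ : ℝ) (Φ : Param D g) (v : Obs D) : ℝ :=
  (∑ j : Fin g, bodyWeight Φ v.2 j *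
      (gammaDens (Real.exp (inner ℝ (Φ.beta j) v.2)) (Φ.phi j) v.1 /
        cdfOf (gammaDens (Real.exp (inner ℝ (Φ.beta j) v.2)) (Φ.phi j)) τ) *
      Set.indicator (Set.Iic τ) 1 v.1) +
    tailWeight Φ v.2 *
      (lomaxDens Φ.theta (Real.exp (inner ℝ Φ.nu v.2)) v.1 /
        (1 - cdfOf (lomaxDens Φ.theta (Real.exp (inner ℝ Φ.nu v.2))) τ)) *
      Set.indicator (Set.Ioi τ) 1 v.1

/-- The dominating measure of `v = (y, x)`: Lebesgue measure for `y`, and the law `G` of the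
covariates for `x`. The density of `v` with respect to it is `dens τ Φ v`. -/
def refMeasure (G : Measure (Cov D)) : Measure (Obs D) := (volume : Measure ℝ).prod G

/-- The law of `v = (Y, x)` under the parameter `Φ`. -/
def modelLaw (τ : ℝ) (G : Measure (Cov D)) (Φ : Param D g) : Measure (Obs D) :=
  (refMeasure G).withDensity fun v => ENNReal.ofReal (dens τ Φ v)

/-! ## Regularity conditions -/

/-- The partial derivative `∂f/∂ψ_j`. -/
def pd (j : ParamIdx D g) (f : Param D g → ℝ) (Φ : Param D g) : ℝ :=
  lineDeriv ℝ f Φ (EuclideanSpace.single j 1)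

/-- The partial derivative of `f` with respect to `ψ_j` exists at `Φ`. -/
def HasPd (j : ParamIdx D g) (f : Param D g → ℝ) (Φ : Param D g) : Prop :=
  LineDifferentiableAt ℝ f Φ (EuclideanSpace.single j 1)

/-- The function `Φ ↦ log h(v; Φ)`. -/
def logDens (τ : ℝ) (v : Obs D) (Φ : Param D g) : ℝ := Real.log (dens τ Φ v)

/-- The score `∂ log h(v; Φ) / ∂ψ_j`. -/
def score (τ : ℝ) (Φ : Param D g) (j : ParamIdx D g) (v : Obs D) : ℝ :=
  pd j (logDens τ v) Φ

/-- The Fisher information matrix at `Φ`. -/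
def fisher (τ : ℝ) (G : Measure (Cov D)) (Φ : Param D g) :
    Matrix (ParamIdx D g) (ParamIdx D g) ℝ :=
  Matrix.of fun i j => ∫ v, score τ Φ i v * score τ Φ j v ∂(modelLaw τ G Φ)

/-- `Φ'` arises from `Φ` by a permutation of the `g` body components. -/
def SameUpToPerm (Φ Φ' : Param D g) : Prop :=
  ∃ σ : Equiv.Perm (Fin g),
    (∀ j, Φ'.alpha j = Φ.alpha (σ j) ∧ Φ'.beta j = Φ.beta (σ j) ∧ Φ'.phi j = Φ.phi (σ j)) ∧
    Φ'.theta = Φ.theta ∧ Φ'.nu = Φ.nu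

/-- The regularity conditions on the model with parameter space `Ω` and true parameter `Φ₀`. -/
structure RegularityConditions (τ : ℝ) (G : Measure (Cov D)) (Ω : Set (Param D g))
    (Φ₀ : Param D g) : Prop where
  /-- Common support. -/
  r1_support : ∀ Φ ∈ Ω, ∀ Φ' ∈ Ω, Function.support (dens τ Φ) = Function.support (dens τ Φ')
  /-- Identifiability up to a permutation of the mixture components. -/
  r1_ident : ∀ Φ ∈ Ω, ∀ Φ' ∈ Ω, dens τ Φ =ᵐ[refMeasure G] dens τ Φ' → SameUpToPerm Φ Φ'
  /-- Existence of the partial derivatives up to the third order, for almost all `v`. -/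
  r2 : ∀ᵐ v ∂(refMeasure G), ∀ Φ ∈ Ω, ∀ j₁ j₂ j₃,
    HasPd j₁ (fun Ψ => dens τ Ψ v) Φ ∧
    HasPd j₂ (pd j₁ fun Ψ => dens τ Ψ v) Φ ∧
    HasPd j₃ (pd j₂ (pd j₁ fun Ψ => dens τ Ψ v)) Φ
  /-- The score has expectation zero. -/
  r3_first : ∀ Φ ∈ Ω, ∀ j, Integrable (score τ Φ j) (modelLaw τ G Φ) ∧
    ∫ v, score τ Φ j v ∂(modelLaw τ G Φ) = 0
  /-- The second information identity. -/
  r3_second : ∀ Φ ∈ Ω, ∀ j₁ j₂,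
    Integrable (fun v => score τ Φ j₁ v * score τ Φ j₂ v) (modelLaw τ G Φ) ∧
    Integrable (fun v => -pd j₂ (pd j₁ (logDens τ v)) Φ) (modelLaw τ G Φ) ∧
    ∫ v, score τ Φ j₁ v * score τ Φ j₂ v ∂(modelLaw τ G Φ) =
      ∫ v, -pd j₂ (pd j₁ (logDens τ v)) Φ ∂(modelLaw τ G Φ)
  /-- The Fisher information at `Φ₀` is finite. -/
  r4_finite : ∀ j₁ j₂, Integrable (fun v => score τ Φ₀ j₁ v * score τ Φ₀ j₂ v) (modelLaw τ G Φ₀)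
  /-- The Fisher information at `Φ₀` is positive definite. -/
  r4_posDef : (fisher τ G Φ₀).PosDef
  /-- The derivatives of the log-density are dominated, near `Φ₀`, by an integrable function. -/
  r5 : ∃ M : Obs D → ℝ, Integrable M (modelLaw τ G Φ₀) ∧ ∃ U ∈ 𝓝 Φ₀,
    ∀ᵐ v ∂(refMeasure G), ∀ Φ ∈ U, ∀ j₁ j₂ j₃,
      |pd j₁ (logDens τ v) Φ| ≤ M v ∧
      |pd j₂ (pd j₁ (logDens τ v)) Φ| ≤ M v ∧
      |pd j₃ (pd j₂ (pd j₁ (logDens τ v))) Φ| ≤ M v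

/-! ## The group-fused penalty -/

/-- The three penalized blocks of regression coefficients, `l = 1, 2, 3`. -/
inductive Block : Type
  | alpha
  | beta
  | nu

/-- `‖cᵀ α‖₂`, `‖cᵀ β‖₂` and `|cᵀ ν|`. (The last column of `α` is zero and adds nothing.) -/
def groupNorm : Block → Cov D → Param D g → ℝ
  | .alpha, c, Φ => ‖(WithLp.toLp 2 fun j => inner ℝ c (Φ.alpha j) : EuclideanSpace ℝ (Fin g))‖
  | .beta, c, Φ => ‖(WithLp.toLp 2 fun j => inner ℝ c (Φ.beta j) : EuclideanSpace ℝ (Fin g))‖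
  | .nu, c, Φ => |inner ℝ c Φ.nu|

/-- A group-fused penalty. The penalty functions `p_{ln}` and the tuning parameters `λ_{lkn}` may
depend on the data (for instance through the numbers of claims below and above the threshold), so
that they are functions on the underlying probability space `S`. -/
structure Penalty (D : ℕ) (S : Type*) where
  /-- The numbers `K_l` of penalty terms. -/
  K : Block → ℕ
  /-- The vectors `c_{lk}`. -/
  c : (l : Block) → Fin (K l) → Cov D
  /-- The penalty functions: `p l n s ψ η` is `p_{ln}(ψ; η)`. -/
  p : Block → ℕ → S → ℝ → ℝ → ℝ
  /-- The tuning parameters: `lam l k n s` is `λ_{lkn}`. -/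
  lam : (l : Block) → Fin (K l) → ℕ → S → ℝ

variable {S : Type*}

/-- The function `ψ ↦ p_{ln}(ψ; λ_{lkn})`. -/
def Penalty.fn (pen : Penalty D S) (l : Block) (k : Fin (pen.K l)) (n : ℕ) (s : S) (ψ : ℝ) : ℝ :=
  pen.p l n s ψ (pen.lam l k n s)

/-- The penalty of one block of coefficients. -/
def Penalty.block (pen : Penalty D S) (l : Block) (n : ℕ) (s : S) (Φ : Param D g) : ℝ :=
  ∑ k, pen.fn l k n s (groupNorm l (pen.c l k) Φ)

/-- The penalty `𝒫_n(Φ)`. -/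
def Penalty.total (pen : Penalty D S) (n : ℕ) (s : S) (Φ : Param D g) : ℝ :=
  pen.block .alpha n s Φ + pen.block .beta n s Φ + pen.block .nu n s Φ

/-- The penalized log-likelihood `ℱ_n(Φ)` of the observations `V_0, …, V_{n-1}`. -/
def penLogLik (τ : ℝ) (V : ℕ → S → Obs D) (pen : Penalty D S) (n : ℕ) (s : S) (Φ : Param D g) : ℝ :=
  (∑ i ∈ Finset.range n, Real.log (dens τ Φ (V i s))) - pen.total n s Φ

/-- `f` is twice differentiable at `ψ` (used off a finite set of exceptional points). -/
def TwiceDiffAt (f : ℝ → ℝ) (ψ : ℝ) : Prop :=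
  DifferentiableAt ℝ f ψ ∧ DifferentiableAt ℝ (deriv f) ψ

/-- The conditions on the penalty functions, at the true parameter `Φ₀`. The set `𝒵_l` consists of
the `k` with `groupNorm l (c_{lk}) Φ₀ = 0`. All stochastic orders are expressed by (outer)
probabilities of exceptional events. -/
structure PenaltyConditions [MeasurableSpace S] (P : Measure S) (pen : Penalty D S)
    (Φ₀ : Param D g) : Prop where
  /-- The penalty functions are concave on `[0, ∞)`. -/
  concave : ∀ l k n s, ConcaveOn ℝ (Set.Ici 0) (pen.fn l k n s)
  h1_zero : ∀ l k n s, pen.fn l k n s 0 = 0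
  h1_mono : ∀ l k n s, MonotoneOn (pen.fn l k n s) (Set.Ici 0)
  h1_diff : ∀ l k n s, ∃ E : Set ℝ, E.Finite ∧ ∀ ψ, 0 < ψ → ψ ∉ E → TwiceDiffAt (pen.fn l k n s) ψ
  /-- For `k ∉ 𝒵_l`, the second derivative divided by `n` is `o_P(1)`, uniformly on each
  neighbourhood of order `n^{-1/2}` of the true value `ψ₀`. -/
  h2 : ∀ l k, groupNorm l (pen.c l k) Φ₀ ≠ 0 → ∀ M > (0 : ℝ), ∀ ε > (0 : ℝ),
    Tendsto (fun n : ℕ => P {s | ¬ ∀ ψ, |ψ - groupNorm l (pen.c l k) Φ₀| ≤ M / √(n : ℝ) →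
      TwiceDiffAt (pen.fn l k n s) ψ ∧ |deriv (deriv (pen.fn l k n s)) ψ| / n ≤ ε}) atTop (𝓝 0)
  /-- For `k ∈ 𝒵_l`, the infimum of `p' / √n` over `0 < ψ ≤ n^{-1/2} log n` tends to infinity in
  probability. -/
  h3 : ∀ l k, groupNorm l (pen.c l k) Φ₀ = 0 → ∀ B : ℝ,
    Tendsto (fun n : ℕ => P {s | ¬ ∀ ψ, 0 < ψ → ψ ≤ Real.log n / √(n : ℝ) →
      DifferentiableAt ℝ (pen.fn l k n s) ψ → B ≤ deriv (pen.fn l k n s) ψ / √(n : ℝ)}) atTop (𝓝 0)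
  /-- For `k ∉ 𝒵_l`, the derivative at the true value divided by `√n` is `O_P(1)`. -/
  h4 : ∀ l k, groupNorm l (pen.c l k) Φ₀ ≠ 0 → ∀ ε : ENNReal, 0 < ε → ∃ B : ℝ, ∀ᶠ n : ℕ in atTop,
    P {s | B < deriv (pen.fn l k n s) (groupNorm l (pen.c l k) Φ₀) / √(n : ℝ)} ≤ ε

end CompositeReg

end

open Filter Topology MeasureTheory ProbabilityTheory

noncomputable section

namespace CompositeReg

variable {D g : ℕ}

/-! ### Calculus with partial derivatives -/

/-! Write `u = Φ - Φ₀` and look at the balls `‖u‖ ≤ K/√n`. There the increment of the log-likelihood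
is a score term, plus half the Hessian form, plus a cubic remainder (`taylor_of_pd`). The score sum
is `O_P(√n)` by Chebyshev, so its term is at most `O_P(1)·K`. By the law of large numbers and the
information identity the Hessian term is `-n/2` times the Fisher form of `u`, up to `o_P(1)`; the
remainder tends to zero in probability.

A penalty term helps a competitor of `Φ₀` only by decreasing. If its group norm vanishes at `Φ₀`,
monotonicity forbids a decrease; otherwise `h2` and `h4` bound the decrease by `O_P(1)·K + o_P(1)`.
So, with probability close to one, the objective on the sphere `‖u‖ = K/√n` exceeds its value at
`Φ₀` by at most `A K + 1 - c K²/2`, where `c > 0` is the minimum of the Fisher form on the unit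
sphere. As `A` is fixed before `K`, a large `K` makes this negative. `LocallyDominated` encodes
exactly this order of quantifiers and is closed under sums.

The objective is almost surely upper semicontinuous on such a ball for large `n`, so it attains a
maximum there, necessarily in the interior. Here `K` depends on `ε`;
`exists_sqrt_consistent_selection` extracts one sequence that serves every `ε`.

Two technical points: only partial derivatives are assumed, so Fréchet differentiability is derived
from bounds on higher partials; and events need not be measurable, so all estimates are inclusions
up to null sets under the outer measure. -/

lemma HasPd.hasDerivAt_path {j : ParamIdx D g} {f : Param D g → ℝ} {b : Param D g} {c t : ℝ}
    (h : HasPd j f (b + (t * c) • EuclideanSpace.single j 1)) :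
    HasDerivAt (fun s : ℝ => f (b + (s * c) • EuclideanSpace.single j 1))
      (pd j f (b + (t * c) • EuclideanSpace.single j 1) * c) t := by
  have h1 := h.hasLineDerivAt
  unfold HasLineDerivAt at h1
  have h2 : HasDerivAt (fun s : ℝ => s * c - t * c) c t := by
    simpa using ((hasDerivAt_id t).mul_const c).sub_const (t * c)
  have h0 : t * c - t * c = 0 := sub_self _
  rw [← h0] at h1
  have h3 := HasDerivAt.comp (h₂ := fun t_1 : ℝ => f (b + (t * c) • EuclideanSpace.single j (1:ℝ) +
    t_1 • EuclideanSpace.single j 1)) t h1 h2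
  refine h3.congr_of_eventuallyEq (Eventually.of_forall fun s => ?_)
  simp only [Function.comp, add_assoc, ← add_smul]
  congr 3
  ring

lemma norm_le_of_abs_coord_le {u v : Param D g} (h : ∀ i, |u i| ≤ |v i|) : ‖u‖ ≤ ‖v‖ := by
  rw [EuclideanSpace.norm_eq, EuclideanSpace.norm_eq]
  refine Real.sqrt_le_sqrt (Finset.sum_le_sum fun i _ => ?_)
  simpa only [Real.norm_eq_abs, sq_abs] using sq_le_sq.2 (h i)

lemma abs_coord_le_norm (u : Param D g) (i : ParamIdx D g) : |u i| ≤ ‖u‖ := by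
  simpa using PiLp.norm_apply_le u i

/-- If all partial derivatives are bounded by `b` on a ball, then the increment from the centre
is at most `N b ‖Φ - a‖`, where `N` is the number of coordinates. -/
lemma abs_sub_le_of_pd_bound {f : Param D g → ℝ} {a Φ : Param D g} {b : ℝ}
    (h : ∀ Ψ, ‖Ψ - a‖ ≤ ‖Φ - a‖ → ∀ j, HasPd j f Ψ ∧ |pd j f Ψ| ≤ b) :
    |f Φ - f a| ≤ Fintype.card (ParamIdx D g) * b * ‖Φ - a‖ := by
  classical
  set u := Φ - a with hu
  have hb : 0 ≤ b := (abs_nonneg _).trans (h a (by simp) (Sum.inr (Sum.inr (Sum.inr (Sum.inl ()))))).2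
  -- `a + w s` has moved to `Φ` in the coordinates of `s` only. Switching on one coordinate at a
  -- time gives a path along which only partial derivatives enter.
  let w : Finset (ParamIdx D g) → Param D g := fun s => WithLp.toLp 2 fun i => if i ∈ s then u i else 0
  have key : ∀ s : Finset (ParamIdx D g), |f (a + w s) - f a| ≤ s.card * b * ‖u‖ := by
    intro s
    induction s using Finset.induction_on with
    | empty =>
      have : w ∅ = 0 := by ext i; simp [w]
      simp [this]
    | insert j s hj ih =>
      -- The path stays in the ball because each of its coordinates is dominated by that of `u`.
      have hpt : ∀ t ∈ Set.Icc (0 : ℝ) 1,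
          ‖(a + w s + (t * u j) • EuclideanSpace.single j (1 : ℝ)) - a‖ ≤ ‖u‖ := by
        intro t ht
        rw [add_assoc, add_sub_cancel_left]
        refine norm_le_of_abs_coord_le fun i => ?_
        by_cases hij : i = j
        · subst hij
          simp only [w, PiLp.add_apply, PiLp.smul_apply, PiLp.single_apply]
          simp only [hj, if_false, if_true, smul_eq_mul, mul_one, zero_add, abs_mul,
            abs_of_nonneg ht.1]
          exact mul_le_of_le_one_left (abs_nonneg _) ht.2
        · by_cases his : i ∈ s <;> simp [w, hij, his]
      have hd := norm_image_sub_le_of_norm_deriv_le_segment_01'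
        (f := fun t : ℝ => f (a + w s + (t * u j) • EuclideanSpace.single j (1 : ℝ)))
        (C := b * ‖u‖)
        (fun t ht => (HasPd.hasDerivAt_path (h _ (hpt t ht) j).1).hasDerivWithinAt)
        (fun t ht => by
          rw [norm_mul]
          exact mul_le_mul (h _ (hpt t ⟨ht.1, ht.2.le⟩) j).2 (abs_coord_le_norm u j)
            (norm_nonneg _) hb)
      have hw : a + w s + ((1 : ℝ) * u j) • EuclideanSpace.single j (1 : ℝ) = a + w (insert j s) := by
        rw [add_assoc]
        congr 1
        ext i
        by_cases hij : i = j
        · subst hij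
          simp [w, hj]
        · simp [w, hij]
      simp only [hw, zero_mul, zero_smul, add_zero, Real.norm_eq_abs] at hd
      rw [Finset.card_insert_of_notMem hj]
      push_cast
      have := abs_sub_le (f (a + w (insert j s))) (f (a + w s)) (f a)
      nlinarith
  have hu' : a + w Finset.univ = Φ := by
    have : w Finset.univ = u := by ext i; simp [w]
    rw [this, hu]; abel
  simpa [hu'] using key Finset.univ

lemma HasPd.sub {j : ParamIdx D g} {f₁ f₂ : Param D g → ℝ} {Φ : Param D g} (h₁ : HasPd j f₁ Φ)
    (h₂ : HasPd j f₂ Φ) :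
    HasPd j (fun Ψ => f₁ Ψ - f₂ Ψ) Φ ∧
      pd j (fun Ψ => f₁ Ψ - f₂ Ψ) Φ = pd j f₁ Φ - pd j f₂ Φ := by
  have h : HasLineDerivAt ℝ (fun Ψ => f₁ Ψ - f₂ Ψ) (pd j f₁ Φ - pd j f₂ Φ) Φ
      (EuclideanSpace.single j 1) := HasDerivAt.sub h₁.hasLineDerivAt h₂.hasLineDerivAt
  exact ⟨h.lineDifferentiableAt, h.lineDeriv⟩

/-- The linear form with coefficients `c`. -/
def coordForm (c : ParamIdx D g → ℝ) : Param D g →L[ℝ] ℝ :=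
  ∑ j, c j • (EuclideanSpace.proj j : Param D g →L[ℝ] ℝ)

lemma coordForm_apply (c : ParamIdx D g → ℝ) (u : Param D g) : coordForm c u = ∑ j, c j * u j := by
  simp only [coordForm, sum_apply, smul_apply, smul_eq_mul]
  rfl

lemma hasPd_coordForm_sub (c : ParamIdx D g → ℝ) (a Φ : Param D g) (j : ParamIdx D g) :
    HasPd j (fun Ψ => coordForm c (Ψ - a)) Φ ∧ pd j (fun Ψ => coordForm c (Ψ - a)) Φ = c j := by
  have h : HasLineDerivAt ℝ (fun Ψ : Param D g => coordForm c (Ψ - a))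
      (coordForm c (EuclideanSpace.single j 1)) Φ (EuclideanSpace.single j 1) := by
    refine HasFDerivAt.hasLineDerivAt (L := coordForm c) ?_ _
    exact (coordForm c).hasFDerivAt.comp Φ ((hasFDerivAt_id Φ).sub_const a)
  refine ⟨h.lineDifferentiableAt, h.lineDeriv.trans ?_⟩
  rw [coordForm_apply, Finset.sum_eq_single j (fun i _ hij => by simp [hij]) (by simp)]
  simp

/-- First-order increment bound: if the partial derivatives of `f` differ from `c` by at most `b` on
a ball, then `f` differs from its linearization by at most `N b ‖Φ - a‖`. -/
lemma abs_sub_coordForm_le {f : Param D g → ℝ} {a Φ : Param D g} {b : ℝ} (c : ParamIdx D g → ℝ)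
    (h : ∀ Ψ, ‖Ψ - a‖ ≤ ‖Φ - a‖ → ∀ j, HasPd j f Ψ ∧ |pd j f Ψ - c j| ≤ b) :
    |f Φ - f a - coordForm c (Φ - a)| ≤ Fintype.card (ParamIdx D g) * b * ‖Φ - a‖ := by
  have := abs_sub_le_of_pd_bound (f := fun Ψ => f Ψ - coordForm c (Ψ - a)) (a := a) (Φ := Φ) (b := b)
    (fun Ψ hΨ j => by
      obtain ⟨h1, h2⟩ := HasPd.sub (h Ψ hΨ j).1 (hasPd_coordForm_sub c a Ψ j).1
      rw [h2, (hasPd_coordForm_sub c a Ψ j).2]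
      exact ⟨h1, (h Ψ hΨ j).2⟩)
  simp only [sub_self, map_zero, sub_zero] at this
  convert this using 2
  ring

/-- A function whose first and second partial derivatives exist near `a`, the second ones being
bounded, is differentiable at `a`. -/
lemma hasFDerivAt_of_pd {f : Param D g → ℝ} {a : Param D g} {r M : ℝ} (hr : 0 < r)
    (h1 : ∀ Ψ, ‖Ψ - a‖ < r → ∀ j, HasPd j f Ψ)
    (h2 : ∀ Ψ, ‖Ψ - a‖ < r → ∀ j k, HasPd k (pd j f) Ψ ∧ |pd k (pd j f) Ψ| ≤ M) :
    HasFDerivAt f (coordForm fun j => pd j f a) a := by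
  set N : ℝ := ((Fintype.card (ParamIdx D g) : ℕ) : ℝ) with hN
  rw [hasFDerivAt_iff_isLittleO]
  -- Bounded second partials make each first partial vary by at most `N M ‖Ψ - a‖`, so the
  -- linearization error is quadratic.
  have hO : (fun Φ => f Φ - f a - coordForm (fun j => pd j f a) (Φ - a)) =O[𝓝 a]
      fun Φ => ‖Φ - a‖ ^ 2 := by
    refine Asymptotics.IsBigO.of_bound (N * (N * M)) ?_
    filter_upwards [Metric.ball_mem_nhds a hr] with Φ hΦ
    rw [mem_ball_iff_norm] at hΦ
    have := abs_sub_coordForm_le (f := f) (a := a) (Φ := Φ) (b := N * M * ‖Φ - a‖)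
      (fun j => pd j f a) (fun Ψ hΨ j => ⟨h1 Ψ (hΨ.trans_lt hΦ) j, by
        have h3 := abs_sub_le_of_pd_bound (f := pd j f) (a := a) (Φ := Ψ) (b := M)
          (fun Ψ' hΨ' k => h2 Ψ' (hΨ'.trans_lt (hΨ.trans_lt hΦ)) j k)
        have hM : 0 ≤ M := (abs_nonneg _).trans
          (h2 a (by simpa using hr) j j).2
        exact h3.trans (by gcongr)⟩)
    rw [Real.norm_eq_abs, norm_pow, norm_norm]
    refine this.trans (le_of_eq ?_)
    ring
  refine hO.trans_isLittleO ?_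
  have : (fun Φ : Param D g => ‖Φ - a‖ ^ 2) =o[𝓝 a] fun Φ => ‖Φ - a‖ := by
    have hc : Tendsto (fun Φ : Param D g => Φ - a) (𝓝 a) (𝓝 0) := by
      have : Continuous fun Φ : Param D g => Φ - a := by fun_prop
      simpa using this.tendsto a
    exact (Asymptotics.isLittleO_norm_pow_id one_lt_two).norm_right.comp_tendsto hc
  exact this.norm_right.of_norm_right.trans_isBigO (Asymptotics.isBigO_refl _ _).norm_left

/-- Second-order Taylor expansion about `a` from bounds on partial derivatives alone. -/
lemma taylor_of_pd {f : Param D g → ℝ} {a Φ : Param D g} {r M : ℝ}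
    (h1 : ∀ Ψ, ‖Ψ - a‖ < r → ∀ j, HasPd j f Ψ)
    (h2 : ∀ Ψ, ‖Ψ - a‖ < r → ∀ j k, HasPd k (pd j f) Ψ ∧ |pd k (pd j f) Ψ| ≤ M)
    (h3 : ∀ Ψ, ‖Ψ - a‖ < r → ∀ j k l, HasPd l (pd k (pd j f)) Ψ ∧ |pd l (pd k (pd j f)) Ψ| ≤ M)
    (hΦ : ‖Φ - a‖ < r) :
    |f Φ - f a - ∑ j, pd j f a * (Φ - a) j -
        (1 / 2) * ∑ j, ∑ k, pd k (pd j f) a * ((Φ - a) j * (Φ - a) k)| ≤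
      (Fintype.card (ParamIdx D g) : ℝ) ^ 3 * M * ‖Φ - a‖ ^ 3 := by
  set N : ℝ := ((Fintype.card (ParamIdx D g) : ℕ) : ℝ) with hN
  have hM : 0 ≤ M := (abs_nonneg _).trans (h2 Φ hΦ (Sum.inr (Sum.inr (Sum.inr (Sum.inl ()))))
    (Sum.inr (Sum.inr (Sum.inr (Sum.inl ()))))).2
  -- Differentiability is needed at every point of the ball, for the chain rule along the segment
  -- from `a` to `Φ`.
  have hdiff : ∀ Ψ, ‖Ψ - a‖ < r → HasFDerivAt f (coordForm fun j => pd j f Ψ) Ψ := by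
    intro Ψ hΨ
    have htri : ∀ Ψ', ‖Ψ' - Ψ‖ < r - ‖Ψ - a‖ → ‖Ψ' - a‖ < r := fun Ψ' h => by
      have := norm_sub_le_norm_sub_add_norm_sub Ψ' Ψ a
      linarith
    exact hasFDerivAt_of_pd (sub_pos.2 hΨ) (fun Ψ' h => h1 Ψ' (htri Ψ' h))
      (fun Ψ' h => h2 Ψ' (htri Ψ' h))
  set u := Φ - a with hu
  have hgrad : ∀ Ψ, ‖Ψ - a‖ ≤ ‖u‖ → ∀ j,
      |pd j f Ψ - pd j f a - ∑ k, pd k (pd j f) a * (Ψ - a) k| ≤ N ^ 2 * M * ‖Ψ - a‖ ^ 2 := by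
    intro Ψ hΨ j
    have hlt : ∀ Ψ', ‖Ψ' - a‖ ≤ ‖Ψ - a‖ → ‖Ψ' - a‖ < r := fun Ψ' h =>
      (h.trans hΨ).trans_lt hΦ
    have := abs_sub_coordForm_le (f := pd j f) (a := a) (Φ := Ψ) (b := N * M * ‖Ψ - a‖)
      (fun k => pd k (pd j f) a) (fun Ψ' hΨ' k => ⟨(h2 Ψ' (hlt Ψ' hΨ') j k).1, by
        have h4 := abs_sub_le_of_pd_bound (f := pd k (pd j f)) (a := a) (Φ := Ψ') (b := M)
          (fun Ψ'' hΨ'' l => h3 Ψ'' (hlt Ψ'' (hΨ''.trans hΨ')) j k l)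
        exact h4.trans (by gcongr)⟩)
    rw [coordForm_apply] at this
    refine this.trans (le_of_eq ?_)
    ring
  have hpt : ∀ t ∈ Set.Icc (0 : ℝ) 1, ‖(a + t • u) - a‖ = t * ‖u‖ := by
    intro t ht
    rw [add_sub_cancel_left, norm_smul, Real.norm_eq_abs, abs_of_nonneg ht.1]
  have hle : ∀ t ∈ Set.Icc (0 : ℝ) 1, ‖(a + t • u) - a‖ ≤ ‖u‖ := by
    intro t ht
    rw [hpt t ht]
    exact mul_le_of_le_one_left (norm_nonneg _) ht.2
  set L := ∑ j, pd j f a * u j with hL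
  set Q := ∑ j, ∑ k, pd k (pd j f) a * (u j * u k) with hQ
  -- Once the quadratic Taylor polynomial along the segment is subtracted, the derivative that is
  -- left is the error in linearizing the gradient, paired with `u`. It is of order `‖u‖³`, and the
  -- mean value inequality finishes.
  have hder : ∀ t ∈ Set.Icc (0 : ℝ) 1,
      HasDerivAt (fun t : ℝ => f (a + t • u) - t * L - t ^ 2 / 2 * Q)
        ((∑ j, pd j f (a + t • u) * u j) - L - t * Q) t := by
    intro t ht
    have hp : HasDerivAt (fun t : ℝ => a + t • u) u t := by
      simpa using ((hasDerivAt_id t).smul_const u).const_add a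
    have e1 := (hdiff (a + t • u) ((hle t ht).trans_lt hΦ)).comp_hasDerivAt t hp
    rw [coordForm_apply] at e1
    have e2 : HasDerivAt (fun t : ℝ => t * L) L t := by
      simpa using (hasDerivAt_id t).mul_const L
    have e3 : HasDerivAt (fun t : ℝ => t ^ 2 / 2 * Q) (t * Q) t := by
      have := (((hasDerivAt_id t).pow 2).div_const 2).mul_const Q
      simpa using this
    exact (e1.sub e2).sub e3
  have hbound : ∀ t ∈ Set.Icc (0 : ℝ) 1,
      |(∑ j, pd j f (a + t • u) * u j) - L - t * Q| ≤ N ^ 3 * M * ‖u‖ ^ 3 := by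
    intro t ht
    have heq : (∑ j, pd j f (a + t • u) * u j) - L - t * Q = ∑ j, (pd j f (a + t • u) - pd j f a -
        ∑ k, pd k (pd j f) a * ((a + t • u) - a) k) * u j := by
      rw [hL, hQ, Finset.mul_sum, ← Finset.sum_sub_distrib, ← Finset.sum_sub_distrib]
      refine Finset.sum_congr rfl fun j _ => ?_
      rw [sub_mul, sub_mul, add_sub_cancel_left, Finset.sum_mul, Finset.mul_sum]
      congr 1
      refine Finset.sum_congr rfl fun k _ => ?_
      simp only [PiLp.smul_apply, smul_eq_mul]
      ring
    rw [heq]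
    refine (Finset.abs_sum_le_sum_abs _ _).trans ?_
    have : ∀ j ∈ Finset.univ, |(pd j f (a + t • u) - pd j f a -
        ∑ k, pd k (pd j f) a * ((a + t • u) - a) k) * u j| ≤ N ^ 2 * M * ‖u‖ ^ 2 * ‖u‖ := by
      intro j _
      rw [abs_mul]
      refine mul_le_mul ((hgrad _ (hle t ht) j).trans ?_) (abs_coord_le_norm u j) (abs_nonneg _)
        (by positivity)
      have := hle t ht
      gcongr
    refine (Finset.sum_le_card_nsmul _ _ _ this).trans (le_of_eq ?_)
    rw [Finset.card_univ, nsmul_eq_mul, ← hN]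
    ring
  have := norm_image_sub_le_of_norm_deriv_le_segment_01'
    (f := fun t : ℝ => f (a + t • u) - t * L - t ^ 2 / 2 * Q)
    (fun t ht => (hder t ht).hasDerivWithinAt)
    (fun t ht => hbound t ⟨ht.1, ht.2.le⟩)
  have ha : a + (1 : ℝ) • u = Φ := by rw [hu]; simp
  simp only [ha, Real.norm_eq_abs] at this
  simp only [zero_smul, add_zero] at this
  refine le_trans (le_of_eq ?_) this
  congr 1
  ring

/-! ### Partial derivatives of the log-density -/

lemma HasPd.congr_on {j : ParamIdx D g} {f₁ f₂ : Param D g → ℝ} {Ω : Set (Param D g)}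
    (hΩ : IsOpen Ω) (h : Set.EqOn f₁ f₂ Ω) {Φ : Param D g} (hΦ : Φ ∈ Ω) (h₂ : HasPd j f₂ Φ) :
    HasPd j f₁ Φ :=
  (h.eventuallyEq_of_mem (hΩ.mem_nhds hΦ)).lineDifferentiableAt_iff.2 h₂

lemma pd_congr_on {j : ParamIdx D g} {f₁ f₂ : Param D g → ℝ} {Ω : Set (Param D g)}
    (hΩ : IsOpen Ω) (h : Set.EqOn f₁ f₂ Ω) {Φ : Param D g} (hΦ : Φ ∈ Ω) :
    pd j f₁ Φ = pd j f₂ Φ :=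
  (h.eventuallyEq_of_mem (hΩ.mem_nhds hΦ)).lineDeriv_eq

lemma HasPd.mul {j : ParamIdx D g} {f₁ f₂ : Param D g → ℝ} {Φ : Param D g} (h₁ : HasPd j f₁ Φ)
    (h₂ : HasPd j f₂ Φ) : HasPd j (fun Ψ => f₁ Ψ * f₂ Ψ) Φ :=
  DifferentiableAt.mul h₁ h₂

lemma HasPd.div {j : ParamIdx D g} {f₁ f₂ : Param D g → ℝ} {Φ : Param D g} (h₁ : HasPd j f₁ Φ)
    (h₂ : HasPd j f₂ Φ) (h0 : f₂ Φ ≠ 0) :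
    HasPd j (fun Ψ => f₁ Ψ / f₂ Ψ) Φ ∧ pd j (fun Ψ => f₁ Ψ / f₂ Ψ) Φ =
      (pd j f₁ Φ * f₂ Φ - f₁ Φ * pd j f₂ Φ) / (f₂ Φ * f₂ Φ) := by
  have h := HasDerivAt.div h₁.hasLineDerivAt h₂.hasLineDerivAt (by simpa using h0)
  simp only [zero_smul, add_zero] at h
  have h' : HasLineDerivAt ℝ (fun Ψ => f₁ Ψ / f₂ Ψ)
      ((pd j f₁ Φ * f₂ Φ - f₁ Φ * pd j f₂ Φ) / f₂ Φ ^ 2) Φ (EuclideanSpace.single j 1) := h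
  exact ⟨h'.lineDifferentiableAt, by rw [← sq]; exact h'.lineDeriv⟩

lemma HasPd.log {j : ParamIdx D g} {f : Param D g → ℝ} {Φ : Param D g} (h : HasPd j f Φ)
    (h0 : f Φ ≠ 0) :
    HasPd j (fun Ψ => Real.log (f Ψ)) Φ ∧ pd j (fun Ψ => Real.log (f Ψ)) Φ = pd j f Φ / f Φ := by
  have h1 := HasDerivAt.log h.hasLineDerivAt (by simpa using h0)
  simp only [zero_smul, add_zero] at h1
  have h' : HasLineDerivAt ℝ (fun Ψ => Real.log (f Ψ)) (pd j f Φ / f Φ) Φ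
      (EuclideanSpace.single j 1) := h1
  exact ⟨h'.lineDifferentiableAt, h'.lineDeriv⟩

/-- The logarithm of a non-vanishing function with partial derivatives up to order three has
partial derivatives up to order three. -/
lemma hasPd_log_of_hasPd {f : Param D g → ℝ} {Ω : Set (Param D g)} (hΩ : IsOpen Ω)
    (h0 : ∀ Φ ∈ Ω, f Φ ≠ 0)
    (h : ∀ Φ ∈ Ω, ∀ j₁ j₂ j₃, HasPd j₁ f Φ ∧ HasPd j₂ (pd j₁ f) Φ ∧
      HasPd j₃ (pd j₂ (pd j₁ f)) Φ) {Φ : Param D g} (hΦ : Φ ∈ Ω) (j₁ j₂ j₃ : ParamIdx D g) :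
    HasPd j₁ (fun Ψ => Real.log (f Ψ)) Φ ∧ HasPd j₂ (pd j₁ fun Ψ => Real.log (f Ψ)) Φ ∧
      HasPd j₃ (pd j₂ (pd j₁ fun Ψ => Real.log (f Ψ))) Φ := by
  -- The quotient formulas hold on all of the open set `Ω`, so they may be differentiated again.
  have e1 : ∀ j, Set.EqOn (pd j fun Ψ => Real.log (f Ψ)) (fun Ψ => pd j f Ψ / f Ψ) Ω :=
    fun j Ψ hΨ => ((h Ψ hΨ j j j).1.log (h0 Ψ hΨ)).2
  have e2 : Set.EqOn (pd j₂ (pd j₁ fun Ψ => Real.log (f Ψ)))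
      (fun Ψ => (pd j₂ (pd j₁ f) Ψ * f Ψ - pd j₁ f Ψ * pd j₂ f Ψ) / (f Ψ * f Ψ)) Ω :=
    fun Ψ hΨ => (pd_congr_on hΩ (e1 j₁) hΨ).trans
      ((h Ψ hΨ j₁ j₂ j₃).2.1.div (h Ψ hΨ j₂ j₂ j₃).1 (h0 Ψ hΨ)).2
  refine ⟨((h Φ hΦ j₁ j₂ j₃).1.log (h0 Φ hΦ)).1, ?_, ?_⟩
  · exact HasPd.congr_on hΩ (e1 j₁) hΦ
      ((h Φ hΦ j₁ j₂ j₃).2.1.div (h Φ hΦ j₂ j₂ j₃).1 (h0 Φ hΦ)).1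
  · refine HasPd.congr_on hΩ e2 hΦ ?_
    have hf := (h Φ hΦ j₃ j₃ j₃).1
    have hn := HasPd.sub ((h Φ hΦ j₁ j₂ j₃).2.2.mul hf)
      ((h Φ hΦ j₁ j₃ j₃).2.1.mul (h Φ hΦ j₂ j₃ j₃).2.1)
    exact (hn.1.div (hf.mul hf) (mul_ne_zero (h0 Φ hΦ) (h0 Φ hΦ))).1

/-- No measurability of `f` is available. For an s-finite `μ` a measurable minorant of the density
defines the same measure, and it vanishes wherever `f` does. -/
lemma ae_withDensity_ofReal_ne_zero {α : Type*} [MeasurableSpace α] (μ : Measure α) [SFinite μ]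
    (f : α → ℝ) : ∀ᵐ v ∂μ.withDensity (fun v => ENNReal.ofReal (f v)), f v ≠ 0 := by
  obtain ⟨h, hm, hle, heq⟩ := exists_measurable_le_withDensity_eq μ fun v => ENNReal.ofReal (f v)
  rw [← heq, ae_withDensity_iff hm]
  refine Eventually.of_forall fun v hv h0 => hv ?_
  simpa [h0] using hle v

/-! ### Averages of independent observations -/

section Averages

variable {S X : Type*} [MeasurableSpace S] [MeasurableSpace X] {P : Measure S}
  {μ : Measure X} {V : ℕ → S → X}

/-- Replacing an a.e. measurable statistic by a measurable version. -/
lemma ae_comp_eq_mk (hV : ∀ i, Measurable (V i)) (hlaw : ∀ i, P.map (V i) = μ) {f : X → ℝ}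
    (hf : AEStronglyMeasurable f μ) : ∀ᵐ s ∂P, ∀ i, f (V i s) = hf.mk f (V i s) := by
  refine ae_all_iff.2 fun i => ?_
  have h := hf.ae_eq_mk
  generalize hf.mk f = f' at h ⊢
  rw [← hlaw i] at h
  exact ae_of_ae_map (hV i).aemeasurable h

variable [IsProbabilityMeasure P]

lemma tendsto_measure_average (hV : ∀ i, Measurable (V i)) (hlaw : ∀ i, P.map (V i) = μ)
    (hind : iIndepFun V P) {f : X → ℝ} (hf : Integrable f μ) {δ : ℝ} (hδ : 0 < δ) :
    Tendsto (fun n : ℕ => P {s | δ ≤ |(∑ i ∈ Finset.range n, f (V i s)) / n - ∫ v, f v ∂μ|})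
      atTop (𝓝 0) := by
  set f' := hf.1.mk f
  have hm : Measurable f' := hf.1.stronglyMeasurable_mk.measurable
  have hf' : Integrable f' μ := hf.congr hf.1.ae_eq_mk
  have hae := ae_comp_eq_mk hV hlaw hf.1
  have hslln := strong_law_ae_real (μ := P) (fun i s => f' (V i s))
    ((integrable_map_measure (by rw [hlaw 0]; exact hf'.1) (hV 0).aemeasurable).1
      (by rw [hlaw 0]; exact hf'))
    (fun i j hij => (hind.indepFun hij).comp hm hm)
    (fun i => (IdentDistrib.mk (hV i).aemeasurable (hV 0).aemeasurable
      (by rw [hlaw i, hlaw 0])).comp hm)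
  have hint : ∫ s, f' (V 0 s) ∂P = ∫ v, f v ∂μ := by
    rw [← integral_map (hV 0).aemeasurable (by rw [hlaw 0]; exact hf'.1), hlaw 0]
    exact (integral_congr_ae hf.1.ae_eq_mk).symm
  rw [hint] at hslln
  have hT := tendstoInMeasure_of_tendsto_ae (μ := P)
    (f := fun (n : ℕ) s => (∑ i ∈ Finset.range n, f' (V i s)) / n)
    (fun n => Measurable.aestronglyMeasurable
      ((Finset.measurable_sum _ fun i _ => hm.comp (hV i)).div_const _)) hslln
  rw [tendstoInMeasure_iff_norm] at hT
  refine (hT δ hδ).congr fun n => measure_congr ?_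
  filter_upwards [hae] with s hs
  simp only [Real.norm_eq_abs, eq_iff_iff]
  change _ ↔ δ ≤ |(∑ i ∈ Finset.range n, f (V i s)) / n - ∫ v, f v ∂μ|
  rw [Finset.sum_congr rfl fun i _ => hs i]
  rfl

/-- Centred sums of square integrable statistics are `O_P(√n)`. -/
lemma exists_measure_sum_le (hV : ∀ i, Measurable (V i)) (hlaw : ∀ i, P.map (V i) = μ)
    (hind : iIndepFun V P) {f : X → ℝ} (hf : Integrable f μ) (hf2 : Integrable (fun v => f v ^ 2) μ)
    (h0 : ∫ v, f v ∂μ = 0) {ε : ENNReal} (hε : 0 < ε) :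
    ∃ B : ℝ, 0 < B ∧ ∀ n : ℕ, 0 < n →
      P {s | B * √(n : ℝ) ≤ |∑ i ∈ Finset.range n, f (V i s)|} ≤ ε := by
  set f' := hf.1.mk f with hf'def
  have hm : Measurable f' := hf.1.stronglyMeasurable_mk.measurable
  have hf' : Integrable f' μ := hf.congr hf.1.ae_eq_mk
  have hL : MemLp f' 2 μ := by
    rw [memLp_two_iff_integrable_sq hf'.1]
    refine hf2.congr ?_
    filter_upwards [hf.1.ae_eq_mk] with v hv
    rw [hv]
  have hae := ae_comp_eq_mk hV hlaw hf.1
  have hLi : ∀ i, MemLp (fun s => f' (V i s)) 2 P := fun i =>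
    MemLp.comp_of_map (by rw [hlaw i]; exact hL) (hV i).aemeasurable
  have hmean : ∀ i, ∫ s, f' (V i s) ∂P = 0 := fun i => by
    rw [← integral_map (hV i).aemeasurable (by rw [hlaw i]; exact hf'.1), hlaw i, ← h0]
    exact (integral_congr_ae hf.1.ae_eq_mk).symm
  have hid : ∀ i, IdentDistrib (fun s => f' (V i s)) (fun s => f' (V 0 s)) P P := fun i =>
    (IdentDistrib.mk (hV i).aemeasurable (hV 0).aemeasurable (by rw [hlaw i, hlaw 0])).comp hm
  set v := variance (fun s => f' (V 0 s)) P with hv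
  have hvn : 0 ≤ v := variance_nonneg _ _
  -- The Chebyshev bound is `v / B²`, free of `n`; using `v + 1` keeps `B` positive when the
  -- variance is zero.
  have hB : ∃ B : ℝ, 0 < B ∧ ENNReal.ofReal (v / B ^ 2) ≤ ε := by
    rcases eq_or_ne ε ⊤ with rfl | hεt
    · exact ⟨1, one_pos, le_top⟩
    · have he : 0 < ε.toReal := ENNReal.toReal_pos hε.ne' hεt
      refine ⟨√((v + 1) / ε.toReal), by positivity, ?_⟩
      rw [Real.sq_sqrt (by positivity), ← ENNReal.ofReal_toReal hεt]
      refine ENNReal.ofReal_le_ofReal ?_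
      rw [ENNReal.toReal_ofReal he.le, div_div_eq_mul_div, div_le_iff₀ (by positivity)]
      nlinarith
  obtain ⟨B, hB0, hB⟩ := hB
  refine ⟨B, hB0, fun n hn => ?_⟩
  have hn' : (0 : ℝ) < n := Nat.cast_pos.2 hn
  have hcheb := meas_ge_le_variance_div_sq (μ := P)
    (X := ∑ i ∈ Finset.range n, fun s => f' (V i s))
    (memLp_finsetSum' _ fun i _ => hLi i) (c := B * √(n : ℝ)) (by positivity)
  rw [IndepFun.variance_sum (fun i _ => hLi i)
    (fun i _ j _ hij => (hind.indepFun hij).comp hm hm),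
    Finset.sum_congr rfl (fun i _ => (hid i).variance_eq)] at hcheb
  have hE : ∫ s, (∑ i ∈ Finset.range n, fun s => f' (V i s)) s ∂P = 0 := by
    simp only [Finset.sum_apply]
    rw [integral_finsetSum _ fun i _ => (hLi i).integrable one_le_two]
    exact Finset.sum_eq_zero fun i _ => hmean i
  rw [hE, Finset.sum_const, Finset.card_range, nsmul_eq_mul, mul_pow, Real.sq_sqrt hn'.le,
    ← hv, mul_comm (B ^ 2), mul_div_mul_left _ _ hn'.ne'] at hcheb
  refine (le_of_eq ?_).trans (hcheb.trans hB)
  refine measure_congr ?_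
  filter_upwards [hae] with s hs
  simp only [eq_iff_iff]
  change B * √(n : ℝ) ≤ |∑ i ∈ Finset.range n, f (V i s)| ↔
    B * √(n : ℝ) ≤ |(∑ i ∈ Finset.range n, fun s => f' (V i s)) s - 0|
  rw [Finset.sum_congr rfl fun i _ => hs i, Finset.sum_apply, sub_zero]

end Averages

/-! ### Random functions dominated at scale `n^{-1/2}` -/

section Domination

variable {S : Type*} [MeasurableSpace S] {P : Measure S} {a : Param D g}

/-- On the balls of radius `K n^{-1/2}` around `a`, the random functions `f n` are at most
`A K + o_P(1)`, where `A = O_P(1)` does not depend on `K`. -/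
def LocallyDominated (P : Measure S) (a : Param D g) (f : ℕ → S → Param D g → ℝ) : Prop :=
  ∀ ε : ENNReal, 0 < ε → ∃ A : ℝ, ∀ K : ℝ, 0 < K → ∀ γ : ℝ, 0 < γ → ∀ᶠ n : ℕ in atTop,
    P {s | ¬ ∀ Φ, ‖Φ - a‖ ≤ K / √(n : ℝ) → f n s Φ ≤ A * K + γ} ≤ ε

lemma locallyDominated_of_nonpos {f : ℕ → S → Param D g → ℝ} (h : ∀ n s Φ, f n s Φ ≤ 0) :
    LocallyDominated P a f := by
  refine fun ε _ => ⟨0, fun K _ γ hγ => Eventually.of_forall fun n => ?_⟩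
  have : {s | ¬ ∀ Φ, ‖Φ - a‖ ≤ K / √(n : ℝ) → f n s Φ ≤ 0 * K + γ} = ∅ := by
    refine Set.eq_empty_of_forall_notMem fun s hs => hs fun Φ _ => ?_
    linarith [h n s Φ]
  rw [this, measure_empty]
  exact zero_le

lemma LocallyDominated.add {f₁ f₂ : ℕ → S → Param D g → ℝ} (h₁ : LocallyDominated P a f₁)
    (h₂ : LocallyDominated P a f₂) : LocallyDominated P a fun n s Φ => f₁ n s Φ + f₂ n s Φ := by
  intro ε hε
  have hε' : 0 < ε / 2 := ENNReal.half_pos hε.ne'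
  obtain ⟨A₁, h₁⟩ := h₁ _ hε'
  obtain ⟨A₂, h₂⟩ := h₂ _ hε'
  refine ⟨A₁ + A₂, fun K hK γ hγ => ?_⟩
  filter_upwards [h₁ K hK _ (half_pos hγ), h₂ K hK _ (half_pos hγ)] with n hn₁ hn₂
  refine le_trans ?_ ((add_le_add hn₁ hn₂).trans_eq (ENNReal.add_halves ε))
  refine (measure_mono fun s hs => ?_).trans (measure_union_le _ _)
  by_contra hc
  simp only [Set.mem_union, Set.mem_ofPred_eq, not_or, not_not] at hc
  refine hs fun Φ hΦ => ?_
  linarith [hc.1 Φ hΦ, hc.2 Φ hΦ]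

lemma LocallyDominated.sum {ι : Type*} (t : Finset ι) {f : ι → ℕ → S → Param D g → ℝ}
    (h : ∀ i ∈ t, LocallyDominated P a (f i)) :
    LocallyDominated P a fun n s Φ => ∑ i ∈ t, f i n s Φ := by
  classical
  induction t using Finset.induction_on with
  | empty => exact locallyDominated_of_nonpos fun n s Φ => by simp
  | insert j t hj ih =>
    simp only [Finset.sum_insert hj]
    exact (h j (Finset.mem_insert_self j t)).add
      (ih fun i hi => h i (Finset.mem_insert_of_mem hi))

lemma tendsto_div_sqrt (K : ℝ) : Tendsto (fun n : ℕ => K / √(n : ℝ)) atTop (𝓝 0) :=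
  tendsto_const_nhds.div_atTop (Real.tendsto_sqrt_atTop.comp tendsto_natCast_atTop_atTop)

/-- The balls shrink into any fixed neighbourhood of `a`, so a comparison valid near `a` for almost
every `s` suffices. -/
lemma LocallyDominated.mono {f f' : ℕ → S → Param D g → ℝ} (h : LocallyDominated P a f) {r : ℝ}
    (hr : 0 < r) (hle : ∀ᵐ s ∂P, ∀ n Φ, ‖Φ - a‖ < r → f' n s Φ ≤ f n s Φ) :
    LocallyDominated P a f' := by
  intro ε hε
  obtain ⟨A, hA⟩ := h ε hε
  refine ⟨A, fun K hK γ hγ => ?_⟩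
  filter_upwards [hA K hK γ hγ, (tendsto_div_sqrt K).eventually (gt_mem_nhds hr)] with n hn hnr
  refine le_trans (measure_mono_ae ?_) hn
  filter_upwards [hle] with s hs hs1 hs2
  exact hs1 fun Φ hΦ => (hs n Φ (hΦ.trans_lt hnr)).trans (hs2 Φ hΦ)

variable {X : Type*} [MeasurableSpace X] [IsProbabilityMeasure P] {μ : Measure X} {V : ℕ → S → X}

lemma locallyDominated_linear (hV : ∀ i, Measurable (V i)) (hlaw : ∀ i, P.map (V i) = μ)
    (hind : iIndepFun V P) {f : X → ℝ} (hf : Integrable f μ) (hf2 : Integrable (fun v => f v ^ 2) μ)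
    (h0 : ∫ v, f v ∂μ = 0) (j : ParamIdx D g) :
    LocallyDominated P a fun n s Φ => (∑ i ∈ Finset.range n, f (V i s)) * (Φ - a) j := by
  intro ε hε
  obtain ⟨B, hB, h⟩ := exists_measure_sum_le hV hlaw hind hf hf2 h0 hε
  refine ⟨B, fun K hK γ hγ => ?_⟩
  filter_upwards [eventually_gt_atTop 0] with n hn
  refine le_trans (measure_mono fun s hs => ?_) (h n hn)
  by_contra hc
  rw [Set.mem_ofPred_eq, not_le] at hc
  refine hs fun Φ hΦ => ?_
  have hn' : 0 < √(n : ℝ) := Real.sqrt_pos.2 (Nat.cast_pos.2 hn)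
  calc (∑ i ∈ Finset.range n, f (V i s)) * (Φ - a) j
      ≤ |∑ i ∈ Finset.range n, f (V i s)| * |(Φ - a) j| := by
        rw [← abs_mul]; exact le_abs_self _
    _ ≤ (B * √(n : ℝ)) * (K / √(n : ℝ)) :=
        mul_le_mul hc.le ((abs_coord_le_norm _ j).trans hΦ) (abs_nonneg _) (by positivity)
    _ = B * K := by field_simp
    _ ≤ B * K + γ := by linarith

/-- The centred sum is `n · o_P(1)` and the product of coordinates is at most `K²/n`, so the term
vanishes for every `K` and `A = 0` works. -/
lemma locallyDominated_quadratic (hV : ∀ i, Measurable (V i)) (hlaw : ∀ i, P.map (V i) = μ)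
    (hind : iIndepFun V P) {f : X → ℝ} (hf : Integrable f μ) (j k : ParamIdx D g) :
    LocallyDominated P a fun n s Φ =>
      (∑ i ∈ Finset.range n, f (V i s) - n * ∫ v, f v ∂μ) * ((Φ - a) j * (Φ - a) k) := by
  refine fun ε hε => ⟨0, fun K hK γ hγ => ?_⟩
  have hδ : 0 < γ / K ^ 2 := by positivity
  filter_upwards [eventually_gt_atTop 0,
    (tendsto_measure_average hV hlaw hind hf hδ).eventually (Iic_mem_nhds hε)] with n hn h
  refine le_trans (measure_mono fun s hs => ?_) h
  by_contra hc
  rw [Set.mem_ofPred_eq, not_le] at hc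
  refine hs fun Φ hΦ => ?_
  have hn0 : (0 : ℝ) < n := Nat.cast_pos.2 hn
  have hn' : 0 < √(n : ℝ) := Real.sqrt_pos.2 hn0
  have hc' : |∑ i ∈ Finset.range n, f (V i s) - n * ∫ v, f v ∂μ| ≤ n * (γ / K ^ 2) := by
    have hfac : ∑ i ∈ Finset.range n, f (V i s) - n * ∫ v, f v ∂μ =
        n * ((∑ i ∈ Finset.range n, f (V i s)) / n - ∫ v, f v ∂μ) := by
      field_simp
    rw [hfac, abs_mul, abs_of_pos hn0]
    exact mul_le_mul_of_nonneg_left hc.le hn0.le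
  have hu : ∀ i, |(Φ - a) i| ≤ K / √(n : ℝ) := fun i => (abs_coord_le_norm _ i).trans hΦ
  calc (∑ i ∈ Finset.range n, f (V i s) - n * ∫ v, f v ∂μ) * ((Φ - a) j * (Φ - a) k)
      ≤ |∑ i ∈ Finset.range n, f (V i s) - n * ∫ v, f v ∂μ| * (|(Φ - a) j| * |(Φ - a) k|) := by
        rw [← abs_mul, ← abs_mul]; exact le_abs_self _
    _ ≤ (n * (γ / K ^ 2)) * (K / √(n : ℝ) * (K / √(n : ℝ))) := by
        refine mul_le_mul hc' (mul_le_mul (hu j) (hu k) (abs_nonneg _) (by positivity))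
          (by positivity) (by positivity)
    _ = γ := by
        rw [div_mul_div_comm, Real.mul_self_sqrt hn0.le]
        field_simp
    _ = 0 * K + γ := by ring

/-- The sum is `O_P(n)`, while `‖Φ - a‖³ ≤ K³ n^{-3/2}`. -/
lemma locallyDominated_cubic (hV : ∀ i, Measurable (V i)) (hlaw : ∀ i, P.map (V i) = μ)
    (hind : iIndepFun V P) {f : X → ℝ} (hf : Integrable f μ) {C : ℝ} (hC : 0 ≤ C) :
    LocallyDominated P a fun n s Φ =>
      C * (∑ i ∈ Finset.range n, f (V i s)) * ‖Φ - a‖ ^ 3 := by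
  refine fun ε hε => ⟨0, fun K hK γ hγ => ?_⟩
  set m := |∫ v, f v ∂μ| + 1 with hm
  have hm0 : 0 < m := by positivity
  filter_upwards [eventually_gt_atTop 0,
    (tendsto_measure_average hV hlaw hind hf one_pos).eventually (Iic_mem_nhds hε),
    (tendsto_div_sqrt (C * m * K ^ 3)).eventually (gt_mem_nhds hγ)] with n hn h hnγ
  refine le_trans (measure_mono fun s hs => ?_) h
  by_contra hc
  rw [Set.mem_ofPred_eq, not_le] at hc
  refine hs fun Φ hΦ => ?_
  have hn0 : (0 : ℝ) < n := Nat.cast_pos.2 hn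
  have hn' : 0 < √(n : ℝ) := Real.sqrt_pos.2 hn0
  have hsum : ∑ i ∈ Finset.range n, f (V i s) ≤ n * m := by
    have h1 := (abs_lt.1 hc).2
    have h2 := le_abs_self (∫ v, f v ∂μ)
    have h3 : (∑ i ∈ Finset.range n, f (V i s)) / n ≤ m := by linarith
    rwa [div_le_iff₀ hn0, mul_comm] at h3
  calc C * (∑ i ∈ Finset.range n, f (V i s)) * ‖Φ - a‖ ^ 3
      ≤ C * (n * m) * ‖Φ - a‖ ^ 3 := by gcongr
    _ ≤ C * (n * m) * (K / √(n : ℝ)) ^ 3 := by gcongr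
    _ = C * m * K ^ 3 / √(n : ℝ) := by
        have : (n : ℝ) = √(n : ℝ) ^ 2 := (Real.sq_sqrt hn0.le).symm
        rw [this, Real.sqrt_sq hn'.le]
        field_simp
    _ ≤ 0 * K + γ := by linarith

end Domination

/-! ### The penalty -/

/-- Handles the three blocks at once: nonnegativity, continuity and the Lipschitz bound all follow
from being the norm of a continuous linear map. -/
lemma exists_groupNorm_eq_norm (l : Block) (c : Cov D) :
    ∃ (m : ℕ) (L : Param D g →L[ℝ] EuclideanSpace ℝ (Fin m)),
      ∀ Φ : Param D g, groupNorm l c Φ = ‖L Φ‖ := by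
  have hα : ∀ j, IsLinearMap ℝ fun Φ : Param D g => inner ℝ c (Φ.alpha j) := fun j =>
    ⟨fun Φ Ψ => by rw [← inner_add_right]; rfl, fun t Φ => by
      rw [smul_eq_mul, ← real_inner_smul_right]; rfl⟩
  have hβ : ∀ j, IsLinearMap ℝ fun Φ : Param D g => inner ℝ c (Φ.beta j) := fun j =>
    ⟨fun Φ Ψ => by rw [← inner_add_right]; rfl, fun t Φ => by
      rw [smul_eq_mul, ← real_inner_smul_right]; rfl⟩
  have hν : IsLinearMap ℝ fun Φ : Param D g => inner ℝ c Φ.nu :=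
    ⟨fun Φ Ψ => by rw [← inner_add_right]; rfl, fun t Φ => by
      rw [smul_eq_mul, ← real_inner_smul_right]; rfl⟩
  have main : ∀ (m : ℕ) (F : Fin m → Param D g → ℝ), (∀ j, IsLinearMap ℝ (F j)) →
      ∃ L : Param D g →L[ℝ] EuclideanSpace ℝ (Fin m), ∀ Φ, L Φ = WithLp.toLp 2 fun j => F j Φ := by
    intro m F hF
    refine ⟨LinearMap.toContinuousLinearMap
      { toFun := fun Φ => WithLp.toLp 2 fun j => F j Φ
        map_add' := fun Φ Ψ => by ext j; exact (hF j).map_add Φ Ψ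
        map_smul' := fun t Φ => by ext j; exact (hF j).map_smul t Φ }, fun Φ => rfl⟩
  cases l with
  | alpha =>
    obtain ⟨L, hL⟩ := main g _ hα
    exact ⟨g, L, fun Φ => by rw [hL]; rfl⟩
  | beta =>
    obtain ⟨L, hL⟩ := main g _ hβ
    exact ⟨g, L, fun Φ => by rw [hL]; rfl⟩
  | nu =>
    obtain ⟨L, hL⟩ := main 1 (fun _ Φ => inner ℝ c Φ.nu) fun _ => hν
    exact ⟨1, L, fun Φ => by rw [hL, EuclideanSpace.norm_eq]; simp [groupNorm, Real.sqrt_sq_eq_abs]⟩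

lemma groupNorm_nonneg (l : Block) (c : Cov D) (Φ : Param D g) : 0 ≤ groupNorm l c Φ := by
  obtain ⟨m, L, hL⟩ := exists_groupNorm_eq_norm (g := g) l c
  rw [hL]; exact norm_nonneg _

lemma continuous_groupNorm (l : Block) (c : Cov D) :
    Continuous fun Φ : Param D g => groupNorm l c Φ := by
  obtain ⟨m, L, hL⟩ := exists_groupNorm_eq_norm (g := g) l c
  simp only [hL]; fun_prop

lemma exists_groupNorm_lipschitz (l : Block) (c : Cov D) :
    ∃ C : ℝ, 0 < C ∧ ∀ Φ Ψ : Param D g, |groupNorm l c Φ - groupNorm l c Ψ| ≤ C * ‖Φ - Ψ‖ := by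
  obtain ⟨m, L, hL⟩ := exists_groupNorm_eq_norm (g := g) l c
  refine ⟨‖L‖ + 1, by positivity, fun Φ Ψ => ?_⟩
  rw [hL, hL]
  refine (abs_norm_sub_norm_le _ _).trans ?_
  rw [← map_sub]
  refine (L.le_opNorm _).trans ?_
  gcongr
  linarith

/-- A differentiable non-decreasing function cannot drop much near `d` if its slope at `d` is at
most `b` and its second derivative is small. -/
lemma sub_le_of_deriv_deriv_le {p : ℝ → ℝ} {d x ρ b e : ℝ} (hmono : MonotoneOn p (Set.Ici 0))
    (hd0 : 0 ≤ d) (hx0 : 0 ≤ x) (hb : 0 ≤ b) (he : 0 ≤ e) (hx : |x - d| ≤ ρ)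
    (h : ∀ ψ, |ψ - d| ≤ ρ → TwiceDiffAt p ψ ∧ |deriv (deriv p) ψ| ≤ e) (hd : deriv p d ≤ b) :
    p d - p x ≤ (b + e * ρ) * ρ := by
  have hρ : 0 ≤ ρ := (abs_nonneg _).trans hx
  rcases le_or_gt d x with hdx | hxd
  · have := hmono hd0 hx0 hdx
    have : 0 ≤ (b + e * ρ) * ρ := by positivity
    linarith
  · have hnear : ∀ ψ ∈ Set.Icc x d, |ψ - d| ≤ ρ := fun ψ hψ => by
      rw [abs_le] at hx ⊢
      constructor <;> linarith [hψ.1, hψ.2]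
    -- Mean value theorem twice: the drop is `p'(ξ)(d - x)`, and `p'(ξ)` exceeds `p'(d)` by at most
    -- `e (d - ξ)`.
    obtain ⟨ξ, hξ, hξe⟩ := exists_deriv_eq_slope p hxd
      (fun ψ hψ => (h ψ (hnear ψ hψ)).1.1.continuousAt.continuousWithinAt)
      (fun ψ hψ => (h ψ (hnear ψ ⟨hψ.1.le, hψ.2.le⟩)).1.1.differentiableWithinAt)
    have hsub : ∀ ψ ∈ Set.Icc ξ d, |ψ - d| ≤ ρ := fun ψ hψ => hnear ψ ⟨hξ.1.le.trans hψ.1, hψ.2⟩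
    obtain ⟨ζ, hζ, hζe⟩ := exists_deriv_eq_slope (deriv p) hξ.2
      (fun ψ hψ => (h ψ (hsub ψ hψ)).1.2.continuousAt.continuousWithinAt)
      (fun ψ hψ => (h ψ (hsub ψ ⟨hψ.1.le, hψ.2.le⟩)).1.2.differentiableWithinAt)
    have hz := neg_le_of_abs_le (h ζ (hsub ζ ⟨hζ.1.le, hζ.2.le⟩)).2
    rw [eq_div_iff (sub_pos.2 hxd).ne'] at hξe
    rw [eq_div_iff (sub_pos.2 hξ.2).ne'] at hζe
    have hdx : d - x ≤ ρ := by rw [abs_le] at hx; linarith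
    have hdξ : d - ξ ≤ ρ := by linarith [hξ.1]
    have hslope : deriv p ξ ≤ b + e * ρ := by nlinarith [hξ.2]
    rw [← hξe]
    calc deriv p ξ * (d - x) ≤ (b + e * ρ) * (d - x) :=
          mul_le_mul_of_nonneg_right hslope (sub_pos.2 hxd).le
      _ ≤ (b + e * ρ) * ρ := mul_le_mul_of_nonneg_left hdx (by positivity)

section PenaltyTerms

variable {S : Type*} [MeasurableSpace S] {P : Measure S} {Φ₀ : Param D g} {pen : Penalty D S}

lemma locallyDominated_penalty_term (hH : PenaltyConditions P pen Φ₀) (l : Block)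
    (k : Fin (pen.K l)) :
    LocallyDominated P Φ₀ fun n s Φ =>
      pen.fn l k n s (groupNorm l (pen.c l k) Φ₀) - pen.fn l k n s (groupNorm l (pen.c l k) Φ) := by
  by_cases h0 : groupNorm l (pen.c l k) Φ₀ = 0
  · refine locallyDominated_of_nonpos fun n s Φ => ?_
    have hx := groupNorm_nonneg l (pen.c l k) Φ
    have := hH.h1_mono l k n s (Set.mem_Ici.2 le_rfl) hx hx
    rw [h0]
    linarith
  · set d := groupNorm l (pen.c l k) Φ₀ with hd
    obtain ⟨C, hC, hlip⟩ := exists_groupNorm_lipschitz (g := g) l (pen.c l k)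
    intro ε hε
    have hε' : 0 < ε / 2 := ENNReal.half_pos hε.ne'
    obtain ⟨B, hB⟩ := hH.h4 l k h0 _ hε'
    refine ⟨max B 0 * C, fun K hK γ hγ => ?_⟩
    -- With `ρ = C K/√n`, slope bound `max B 0 · √n` and `e = n γ/(C K)²`, the drop `(b + e ρ) ρ`
    -- equals `max B 0 · C · K + γ`.
    have he : 0 < γ / (C * K) ^ 2 := by positivity
    filter_upwards [eventually_gt_atTop 0, hB,
      (hH.h2 l k h0 (C * K) (by positivity) _ he).eventually (Iic_mem_nhds hε')] with n hn hn4 hn2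
    refine le_trans ?_ ((add_le_add hn4 hn2).trans_eq (ENNReal.add_halves ε))
    refine (measure_mono fun s hs => ?_).trans (measure_union_le _ _)
    by_contra hc
    simp only [Set.mem_union, Set.mem_ofPred_eq, not_or, not_not, not_lt] at hc
    obtain ⟨hc4, hc2⟩ := hc
    have hn0 : (0 : ℝ) < n := Nat.cast_pos.2 hn
    have hn' : 0 < √(n : ℝ) := Real.sqrt_pos.2 hn0
    refine hs fun Φ hΦ => ?_
    have hx : |groupNorm l (pen.c l k) Φ - d| ≤ C * K / √(n : ℝ) := by
      refine (hlip Φ Φ₀).trans ?_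
      rw [mul_div_assoc]
      gcongr
    have hb : deriv (pen.fn l k n s) d ≤ max B 0 * √(n : ℝ) := by
      rw [← div_le_iff₀ hn']
      exact hc4.trans (le_max_left _ _)
    refine (sub_le_of_deriv_deriv_le (e := n * (γ / (C * K) ^ 2)) (hH.h1_mono l k n s)
      (groupNorm_nonneg _ _ _) (groupNorm_nonneg _ _ _) (by positivity) (by positivity) hx (fun ψ hψ => ⟨(hc2 ψ hψ).1, ?_⟩)
      hb).trans (le_of_eq ?_)
    · rw [← div_le_iff₀' hn0]
      exact (hc2 ψ hψ).2
    · have : (n : ℝ) = √(n : ℝ) ^ 2 := (Real.sq_sqrt hn0.le).symm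
      rw [this, Real.sqrt_sq hn'.le]
      field_simp

lemma locallyDominated_penalty (hH : PenaltyConditions P pen Φ₀) :
    LocallyDominated P Φ₀ fun n s Φ => pen.total n s Φ₀ - pen.total n s Φ := by
  have hb : ∀ l, LocallyDominated P Φ₀ fun n s Φ => pen.block l n s Φ₀ - pen.block l n s Φ := by
    intro l
    simp only [Penalty.block, ← Finset.sum_sub_distrib]
    exact LocallyDominated.sum _ fun k _ => locallyDominated_penalty_term hH l k
  refine (((hb .alpha).add (hb .beta)).add (hb .nu)).mono one_pos
    (Eventually.of_forall fun s n Φ _ => le_of_eq ?_)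
  simp only [Penalty.total]
  ring

/-- A concave non-decreasing function on `[0, ∞)` is lower semicontinuous there. -/
lemma lowerSemicontinuousOn_of_concaveOn_monotoneOn {p : ℝ → ℝ} (hc : ConcaveOn ℝ (Set.Ici 0) p)
    (hm : MonotoneOn p (Set.Ici 0)) : LowerSemicontinuousOn p (Set.Ici 0) := by
  intro x hx y hy
  rcases (Set.mem_Ici.1 hx).eq_or_lt with rfl | hx
  · filter_upwards [self_mem_nhdsWithin] with z hz
    exact hy.trans_le (hm (Set.mem_Ici.2 le_rfl) hz hz)
  · have h := hc.continuousOn_interior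
    rw [interior_Ici] at h
    exact ((h.continuousAt (Ioi_mem_nhds hx)).eventually (lt_mem_nhds hy)).filter_mono
      nhdsWithin_le_nhds

/-- A penalty function may jump upwards at zero, so continuity can fail; lower semicontinuity
survives and is all that a maximum of the objective needs. -/
lemma lowerSemicontinuous_penalty (hH : PenaltyConditions P pen Φ₀) (n : ℕ) (s : S) :
    LowerSemicontinuous fun Φ : Param D g => pen.total n s Φ := by
  have hb : ∀ l, LowerSemicontinuous fun Φ : Param D g => pen.block l n s Φ := by
    intro l
    refine lowerSemicontinuous_sum fun k _ Φ y hy => ?_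
    have h := lowerSemicontinuousOn_of_concaveOn_monotoneOn (hH.concave l k n s) (hH.h1_mono l k n s)
      _ (groupNorm_nonneg l (pen.c l k) Φ) y hy
    exact (tendsto_nhdsWithin_iff.2 ⟨(continuous_groupNorm l (pen.c l k)).tendsto Φ,
      Eventually.of_forall fun Ψ => groupNorm_nonneg l (pen.c l k) Ψ⟩).eventually h
  exact ((hb .alpha).add (hb .beta)).add (hb .nu)

end PenaltyTerms

/-! ### The log-likelihood -/

/-- `f` has partial derivatives up to order three on a ball of radius `r` around `a`, those of order
two and three being bounded by `M`. -/
structure SmoothOnBall (f : Param D g → ℝ) (a : Param D g) (r M : ℝ) : Prop where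
  first : ∀ Ψ, ‖Ψ - a‖ < r → ∀ j, HasPd j f Ψ
  second : ∀ Ψ, ‖Ψ - a‖ < r → ∀ j k, HasPd k (pd j f) Ψ ∧ |pd k (pd j f) Ψ| ≤ M
  third : ∀ Ψ, ‖Ψ - a‖ < r → ∀ j k l,
    HasPd l (pd k (pd j f)) Ψ ∧ |pd l (pd k (pd j f)) Ψ| ≤ M

lemma SmoothOnBall.continuousAt {f : Param D g → ℝ} {a Φ : Param D g} {r M : ℝ}
    (h : SmoothOnBall f a r M) (hΦ : ‖Φ - a‖ < r) : ContinuousAt f Φ := by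
  have htri : ∀ Ψ, ‖Ψ - Φ‖ < r - ‖Φ - a‖ → ‖Ψ - a‖ < r := fun Ψ hΨ => by
    have := norm_sub_le_norm_sub_add_norm_sub Ψ Φ a
    linarith
  exact (hasFDerivAt_of_pd (sub_pos.2 hΦ) (fun Ψ hΨ => h.first Ψ (htri Ψ hΨ))
    (fun Ψ hΨ => h.second Ψ (htri Ψ hΨ))).continuousAt

/-- Almost every observation has positive density at `Φ₀`, and the common support carries
non-vanishing to all of `Ω`, so the logarithm inherits the partial derivatives of the density. -/
lemma exists_smoothOnBall {τ : ℝ} {G : Measure (Cov D)} [SFinite G] {Ω : Set (Param D g)}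
    (hΩ : IsOpen Ω) {Φ₀ : Param D g} (hΦ₀ : Φ₀ ∈ Ω) (hR : RegularityConditions τ G Ω Φ₀) :
    ∃ M : Obs D → ℝ, Integrable M (modelLaw τ G Φ₀) ∧ ∃ r > 0, Metric.ball Φ₀ r ⊆ Ω ∧
      ∀ᵐ v ∂(modelLaw τ G Φ₀), SmoothOnBall (logDens τ v) Φ₀ r (M v) := by
  obtain ⟨M, hM, U, hU, hbound⟩ := hR.r5
  obtain ⟨r, hr, hball⟩ := Metric.mem_nhds_iff.1 (inter_mem (hΩ.mem_nhds hΦ₀) hU)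
  refine ⟨M, hM, r, hr, fun Φ hΦ => (hball hΦ).1, ?_⟩
  have hac : modelLaw τ G Φ₀ ≪ refMeasure G := withDensity_absolutelyContinuous _ _
  have : SFinite (refMeasure G) := by unfold refMeasure; infer_instance
  have hne : ∀ᵐ v ∂(modelLaw τ G Φ₀), dens τ Φ₀ v ≠ 0 :=
    ae_withDensity_ofReal_ne_zero (refMeasure G) (dens τ Φ₀)
  filter_upwards [hne, hac.ae_le hR.r2, hac.ae_le hbound] with v hv hd hb
  have h0 : ∀ Φ ∈ Ω, dens τ Φ v ≠ 0 := fun Φ hΦ => by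
    have := hR.r1_support Φ hΦ Φ₀ hΦ₀
    exact (Set.ext_iff.1 this v).2 hv
  have hin : ∀ Ψ, ‖Ψ - Φ₀‖ < r → Ψ ∈ Ω ∧ Ψ ∈ U := fun Ψ hΨ =>
    hball (mem_ball_iff_norm.2 hΨ)
  have key := fun Ψ hΨ => hasPd_log_of_hasPd (f := fun Ψ => dens τ Ψ v) hΩ h0 hd (Φ := Ψ) hΨ
  exact ⟨fun Ψ hΨ j => (key Ψ (hin Ψ hΨ).1 j j j).1,
    fun Ψ hΨ j k => ⟨(key Ψ (hin Ψ hΨ).1 j k k).2.1, (hb Ψ (hin Ψ hΨ).2 j k k).2.1⟩,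
    fun Ψ hΨ j k l => ⟨(key Ψ (hin Ψ hΨ).1 j k l).2.2, (hb Ψ (hin Ψ hΨ).2 j k l).2.2⟩⟩

/-- The log-likelihood of the first `n` observations. -/
def logLik {S : Type*} (τ : ℝ) (V : ℕ → S → Obs D) (n : ℕ) (s : S) (Φ : Param D g) : ℝ :=
  ∑ i ∈ Finset.range n, logDens τ (V i s) Φ

/-- The quadratic form of the Fisher information. -/
def fisherForm (τ : ℝ) (G : Measure (Cov D)) (Φ₀ u : Param D g) : ℝ :=
  ∑ j, ∑ k, fisher τ G Φ₀ j k * (u j * u k)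

/-- Compactness of the unit sphere gives a positive minimum, and homogeneity of degree two extends
it. -/
lemma exists_fisherForm_ge {τ : ℝ} {G : Measure (Cov D)} {Φ₀ : Param D g}
    (h : (fisher τ G Φ₀).PosDef) :
    ∃ c > 0, ∀ u : Param D g, c * ‖u‖ ^ 2 ≤ fisherForm τ G Φ₀ u := by
  have hpos : ∀ u : Param D g, u ≠ 0 → 0 < fisherForm τ G Φ₀ u := by
    intro u hu
    have h1 := h.dotProduct_mulVec_pos (x := u.ofLp) (fun h0 => hu (by ext i; exact congrFun h0 i))
    refine h1.trans_eq ?_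
    simp only [dotProduct, Matrix.mulVec, fisherForm, Pi.star_apply, star_trivial, Finset.mul_sum]
    refine Finset.sum_congr rfl fun j _ => Finset.sum_congr rfl fun k _ => ?_
    ring
  have hcont : Continuous fun u : Param D g => fisherForm τ G Φ₀ u := by
    unfold fisherForm; fun_prop
  have hne : (Metric.sphere (0 : Param D g) 1).Nonempty :=
    ⟨EuclideanSpace.single (Sum.inr (Sum.inr (Sum.inr (Sum.inl ())))) 1, by simp⟩
  obtain ⟨w, hw, hmin⟩ := (isCompact_sphere (0 : Param D g) 1).exists_isMinOn hne hcont.continuousOn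
  have hw0 : w ≠ 0 := by
    rintro rfl
    simp at hw
  refine ⟨fisherForm τ G Φ₀ w, hpos w hw0, fun u => ?_⟩
  rcases eq_or_ne u 0 with rfl | hu
  · simp [fisherForm]
  · have hu' : 0 < ‖u‖ := norm_pos_iff.2 hu
    have hscale : fisherForm τ G Φ₀ u = ‖u‖ ^ 2 * fisherForm τ G Φ₀ (‖u‖⁻¹ • u) := by
      simp only [fisherForm, Finset.mul_sum, PiLp.smul_apply, smul_eq_mul]
      refine Finset.sum_congr rfl fun j _ => Finset.sum_congr rfl fun k _ => ?_
      field_simp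
    rw [hscale, mul_comm]
    refine mul_le_mul_of_nonneg_left (hmin ?_) (by positivity)
    simp [norm_smul, hu'.ne']

section Likelihood

variable {τ : ℝ} {G : Measure (Cov D)} [SFinite G] {Ω : Set (Param D g)} {Φ₀ : Param D g}
  {S : Type*} [MeasurableSpace S] {P : Measure S} [IsProbabilityMeasure P] {V : ℕ → S → Obs D}

/-- Local asymptotic quadratic bound for the log-likelihood. -/
lemma locallyDominated_logLik (hΩ : IsOpen Ω) (hΦ₀ : Φ₀ ∈ Ω)
    (hR : RegularityConditions τ G Ω Φ₀) (hV : ∀ i, Measurable (V i))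
    (hind : iIndepFun V P) (hlaw : ∀ i, P.map (V i) = modelLaw τ G Φ₀) :
    LocallyDominated P Φ₀ fun n s Φ =>
      logLik τ V n s Φ - logLik τ V n s Φ₀ + (1 / 2) * n * fisherForm τ G Φ₀ (Φ - Φ₀) := by
  obtain ⟨M, hM, r, hr, -, hsm⟩ := exists_smoothOnBall hΩ hΦ₀ hR
  have hlin : LocallyDominated P Φ₀ fun n s Φ =>
      ∑ j, (∑ i ∈ Finset.range n, score τ Φ₀ j (V i s)) * (Φ - Φ₀) j :=
    LocallyDominated.sum _ fun j _ => locallyDominated_linear hV hlaw hind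
      (hR.r3_first Φ₀ hΦ₀ j).1 (by simpa only [sq] using hR.r4_finite j j)
      (hR.r3_first Φ₀ hΦ₀ j).2 j
  have hquad : LocallyDominated P Φ₀ fun n s Φ => ∑ j, ∑ k,
      (∑ i ∈ Finset.range n, (1 / 2) * pd k (pd j (logDens τ (V i s))) Φ₀ -
        n * ∫ v, (1 / 2) * pd k (pd j (logDens τ v)) Φ₀ ∂(modelLaw τ G Φ₀)) *
      ((Φ - Φ₀) j * (Φ - Φ₀) k) :=
    LocallyDominated.sum _ fun j _ => LocallyDominated.sum _ fun k _ =>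
      locallyDominated_quadratic hV hlaw hind
        (f := fun v => (1 / 2) * pd k (pd j (logDens τ v)) Φ₀)
        (by simpa using (hR.r3_second Φ₀ hΦ₀ j k).2.1.neg.const_mul (1 / 2)) j k
  have hcub := locallyDominated_cubic (a := Φ₀) hV hlaw hind hM
    (C := (Fintype.card (ParamIdx D g) : ℝ) ^ 3) (by positivity)
  refine ((hlin.add hquad).add hcub).mono hr ?_
  have hsm' : ∀ᵐ s ∂P, ∀ i, SmoothOnBall (logDens τ (V i s)) Φ₀ r (M (V i s)) :=
    ae_all_iff.2 fun i => ae_of_ae_map (hV i).aemeasurable (by rw [hlaw i]; exact hsm)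
  filter_upwards [hsm'] with s hs n Φ hΦ
  -- The information identity turns the mean Hessian into minus the Fisher matrix.
  have hint : ∀ j k, ∫ v, (1 / 2) * pd k (pd j (logDens τ v)) Φ₀ ∂(modelLaw τ G Φ₀) =
      -((1 / 2) * fisher τ G Φ₀ j k) := fun j k => by
    have h := (hR.r3_second Φ₀ hΦ₀ j k).2.2
    rw [integral_neg] at h
    rw [integral_const_mul, fisher, Matrix.of_apply, h]
    ring
  set u := Φ - Φ₀ with hu
  have htaylor : ∀ i ∈ Finset.range n, logDens τ (V i s) Φ - logDens τ (V i s) Φ₀ ≤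
      (∑ j, score τ Φ₀ j (V i s) * u j +
        ∑ j, ∑ k, (1 / 2) * pd k (pd j (logDens τ (V i s))) Φ₀ * (u j * u k)) +
        (Fintype.card (ParamIdx D g) : ℝ) ^ 3 * M (V i s) * ‖u‖ ^ 3 := fun i _ => by
    have h := (abs_le.1 (taylor_of_pd (hs i).first (hs i).second (hs i).third hΦ)).2
    simp only [Finset.mul_sum] at h
    simp only [score, mul_assoc] at h ⊢
    linarith
  have hsum := Finset.sum_le_sum htaylor
  rw [Finset.sum_sub_distrib] at hsum
  simp only [logLik]
  refine (add_le_add_left hsum _).trans (le_of_eq ?_)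
  have e1 : ∑ i ∈ Finset.range n, ∑ j, score τ Φ₀ j (V i s) * u j =
      ∑ j, (∑ i ∈ Finset.range n, score τ Φ₀ j (V i s)) * u j := by
    rw [Finset.sum_comm]
    simp only [Finset.sum_mul]
  have e2 : ∑ i ∈ Finset.range n,
        ∑ j, ∑ k, (1 / 2) * pd k (pd j (logDens τ (V i s))) Φ₀ * (u j * u k) =
      ∑ j, ∑ k, (∑ i ∈ Finset.range n, (1 / 2) * pd k (pd j (logDens τ (V i s))) Φ₀) *
        (u j * u k) := by
    rw [Finset.sum_comm]
    refine Finset.sum_congr rfl fun j _ => ?_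
    rw [Finset.sum_comm]
    simp only [Finset.sum_mul]
  have e3 : ∑ j, ∑ k, (∑ i ∈ Finset.range n, (1 / 2) * pd k (pd j (logDens τ (V i s))) Φ₀ -
        n * ∫ v, (1 / 2) * pd k (pd j (logDens τ v)) Φ₀ ∂(modelLaw τ G Φ₀)) * (u j * u k) =
      ∑ j, ∑ k, (∑ i ∈ Finset.range n, (1 / 2) * pd k (pd j (logDens τ (V i s))) Φ₀) *
        (u j * u k) + (1 / 2) * n * fisherForm τ G Φ₀ u := by
    simp only [fisherForm, Finset.mul_sum, hint, ← Finset.sum_add_distrib]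
    refine Finset.sum_congr rfl fun j _ => Finset.sum_congr rfl fun k _ => ?_
    ring
  have e4 : ∑ i ∈ Finset.range n, (Fintype.card (ParamIdx D g) : ℝ) ^ 3 * M (V i s) * ‖u‖ ^ 3 =
      (Fintype.card (ParamIdx D g) : ℝ) ^ 3 * (∑ i ∈ Finset.range n, M (V i s)) * ‖u‖ ^ 3 := by
    rw [Finset.mul_sum, Finset.sum_mul]
  rw [Finset.sum_add_distrib, Finset.sum_add_distrib, e1, e2, e3, e4]
  ring

end Likelihood

/-! ### Local maximizers -/

/-- An upper semicontinuous function that is smaller on a sphere than at the centre has a local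
maximizer inside. -/
lemma exists_isLocalMax_of_sphere_lt {f : Param D g → ℝ} {a : Param D g} {ρ : ℝ} (hρ : 0 < ρ)
    (husc : UpperSemicontinuousOn f (Metric.closedBall a ρ))
    (hlt : ∀ Φ, ‖Φ - a‖ = ρ → f Φ < f a) :
    ∃ Φ, ‖Φ - a‖ < ρ ∧ IsLocalMax f Φ := by
  obtain ⟨Φ, hΦ, hmax⟩ := husc.exists_isMaxOn ⟨a, Metric.mem_closedBall_self hρ.le⟩
    (isCompact_closedBall a ρ)
  have hlt' : ‖Φ - a‖ < ρ := by
    refine lt_of_le_of_ne (mem_closedBall_iff_norm.1 hΦ) fun h => ?_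
    exact absurd (hmax (Metric.mem_closedBall_self hρ.le)) (not_le.2 (hlt Φ h))
  refine ⟨Φ, hlt', hmax.isLocalMax ?_⟩
  exact mem_of_superset (Metric.isOpen_ball.mem_nhds (mem_ball_iff_norm.2 hlt'))
    Metric.ball_subset_closedBall

/-- If for each `ε` there is a `K` such that, with probability at least `1 - ε`, a point with
property `Q n s` exists at distance at most `K n^{-1/2}` from `a`, then such points can be chosen
for all `n` and `s` simultaneously. -/
lemma exists_sqrt_consistent_selection {S : Type*} [MeasurableSpace S] {P : Measure S}
    (a : Param D g) (Q : ℕ → S → Param D g → Prop)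
    (h : ∀ ε : ENNReal, 0 < ε → ∃ K : ℝ, ∀ᶠ n : ℕ in atTop,
      P {s | ¬ ∃ Φ, Q n s Φ ∧ ‖Φ - a‖ ≤ K / √(n : ℝ)} ≤ ε) :
    ∃ F : ℕ → S → Param D g, Tendsto (fun n : ℕ => P {s | ¬ Q n s (F n s)}) atTop (𝓝 0) ∧
      ∀ ε : ENNReal, 0 < ε → ∃ M : ℝ, ∀ᶠ n : ℕ in atTop,
        P {s | M * (n : ℝ) ^ (-(1 / 2) : ℝ) < ‖F n s - a‖} ≤ ε := by
  classical
  let E : ℕ → S → ℕ → Prop := fun n s m => ∃ Φ, Q n s Φ ∧ ‖Φ - a‖ ≤ m / √(n : ℝ)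
  -- Choosing a point for the least admissible integer radius makes it admissible for every larger
  -- one, so the choice does not depend on `ε`. Where no radius works, `a` is a dummy value.
  have hF : ∀ n s, ∃ Φ, ∀ m, E n s m → Q n s Φ ∧ ‖Φ - a‖ ≤ m / √(n : ℝ) := by
    intro n s
    by_cases hex : ∃ m, E n s m
    · obtain ⟨Φ, hΦ, hle⟩ := Nat.find_spec hex
      refine ⟨Φ, fun m hm => ⟨hΦ, hle.trans ?_⟩⟩
      have : (Nat.find hex : ℝ) ≤ m := Nat.cast_le.2 (Nat.find_min' hex hm)
      gcongr
    · exact ⟨a, fun m hm => absurd ⟨m, hm⟩ hex⟩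
  choose F hF using hF
  have hE : ∀ ε : ENNReal, 0 < ε → ∃ m : ℕ, ∀ᶠ n : ℕ in atTop, P {s | ¬ E n s m} ≤ ε := by
    intro ε hε
    obtain ⟨K, hK⟩ := h ε hε
    obtain ⟨m, hm⟩ := exists_nat_ge K
    refine ⟨m, hK.mono fun n hn => (measure_mono fun s hs => ?_).trans hn⟩
    rintro ⟨Φ, hQ, hle⟩
    exact hs ⟨Φ, hQ, hle.trans (by gcongr)⟩
  refine ⟨F, ?_, fun ε hε => ?_⟩
  · rw [ENNReal.tendsto_nhds_zero]
    intro ε hε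
    obtain ⟨m, hm⟩ := hE ε hε
    refine hm.mono fun n hn => (measure_mono fun s hs => ?_).trans hn
    exact fun hEs => hs (hF n s m hEs).1
  · obtain ⟨m, hm⟩ := hE ε hε
    refine ⟨m, hm.mono fun n hn => (measure_mono fun s hs hEs => ?_).trans hn⟩
    refine absurd (hF n s m hEs).2 (not_le.2 (lt_of_eq_of_lt ?_ hs))
    rw [Real.rpow_neg (Nat.cast_nonneg n), ← Real.sqrt_eq_rpow, div_eq_mul_inv]

lemma exists_isLocalMax_penLogLik {τ : ℝ} {G : Measure (Cov D)} [SFinite G]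
    {Ω : Set (Param D g)} {Φ₀ : Param D g} {S : Type*} [MeasurableSpace S] {P : Measure S}
    [IsProbabilityMeasure P] {V : ℕ → S → Obs D} {pen : Penalty D S} (hΩ : IsOpen Ω) (hΦ₀ : Φ₀ ∈ Ω)
    (hR : RegularityConditions τ G Ω Φ₀) (hV : ∀ i, Measurable (V i))
    (hind : iIndepFun V P) (hlaw : ∀ i, P.map (V i) = modelLaw τ G Φ₀)
    (hH : PenaltyConditions P pen Φ₀) {ε : ENNReal} (hε : 0 < ε) :
    ∃ K : ℝ, ∀ᶠ n : ℕ in atTop, P {s | ¬ ∃ Φ, (Φ ∈ Ω ∧ IsLocalMax (penLogLik τ V pen n s) Φ) ∧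
      ‖Φ - Φ₀‖ ≤ K / √(n : ℝ)} ≤ ε := by
  obtain ⟨M, -, r, hr, hball, hsm⟩ := exists_smoothOnBall hΩ hΦ₀ hR
  obtain ⟨c, hc, hcoer⟩ := exists_fisherForm_ge hR.r4_posDef
  obtain ⟨A, hA⟩ := (locallyDominated_logLik hΩ hΦ₀ hR hV hind hlaw).add
    (locallyDominated_penalty hH) ε hε
  -- The quadratic gain beats the linear loss; the `1` absorbs the `o_P(1)` part, through `γ = 1`
  -- below.
  obtain ⟨K, hK, hKA⟩ : ∃ K : ℝ, 0 < K ∧ A * K + 1 < (1 / 2) * (c * K ^ 2) := by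
    refine ⟨2 * (|A| + 1) / c + 1, by positivity, ?_⟩
    set K := 2 * (|A| + 1) / c + 1 with hK
    have hK1 : 1 ≤ K := le_add_of_nonneg_left (by positivity)
    have hcK : c * K = 2 * (|A| + 1) + c := by rw [hK]; field_simp
    nlinarith [le_abs_self A]
  refine ⟨K, ?_⟩
  have hsm' : ∀ᵐ s ∂P, ∀ i, SmoothOnBall (logDens τ (V i s)) Φ₀ r (M (V i s)) :=
    ae_all_iff.2 fun i => ae_of_ae_map (hV i).aemeasurable (by rw [hlaw i]; exact hsm)
  filter_upwards [hA K hK 1 one_pos, eventually_gt_atTop 0,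
    (tendsto_div_sqrt K).eventually (gt_mem_nhds hr)] with n hn hn0 hnr
  refine le_trans (measure_mono_ae ?_) hn
  filter_upwards [hsm'] with s hs hs1 hs2
  refine hs1 ?_
  have hn1 : (0 : ℝ) < n := Nat.cast_pos.2 hn0
  have hρ : 0 < K / √(n : ℝ) := div_pos hK (Real.sqrt_pos.2 hn1)
  have hpen : ∀ Φ : Param D g, penLogLik τ V pen n s Φ = logLik τ V n s Φ + -pen.total n s Φ :=
    fun Φ => sub_eq_add_neg _ _
  have husc : UpperSemicontinuousOn (penLogLik τ V pen n s)
      (Metric.closedBall Φ₀ (K / √(n : ℝ))) := by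
    rw [funext hpen]
    refine UpperSemicontinuousOn.add (ContinuousOn.upperSemicontinuousOn ?_)
      (UpperSemicontinuous.upperSemicontinuousOn ?_ _)
    · refine continuousOn_finsetSum _ fun i _ Φ hΦ => ?_
      exact ((hs i).continuousAt
        ((mem_closedBall_iff_norm.1 hΦ).trans_lt hnr)).continuousWithinAt
    · intro Φ y hy
      have := lowerSemicontinuous_penalty (g := g) hH n s Φ (-y) (by linarith)
      filter_upwards [this] with Ψ hΨ
      linarith
  obtain ⟨Φ, hΦ, hmax⟩ := exists_isLocalMax_of_sphere_lt hρ husc fun Φ hΦ => by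
    have h1 := hs2 Φ hΦ.le
    have h2 := hcoer (Φ - Φ₀)
    rw [hΦ, div_pow, Real.sq_sqrt hn1.le] at h2
    have h3 : c * K ^ 2 ≤ n * fisherForm τ G Φ₀ (Φ - Φ₀) := by
      calc c * K ^ 2 = n * (c * (K ^ 2 / n)) := by field_simp
        _ ≤ _ := mul_le_mul_of_nonneg_left h2 hn1.le
    rw [hpen, hpen]
    linarith
  exact ⟨Φ, ⟨hball (mem_ball_iff_norm.2 (hΦ.trans hnr)), hmax⟩, hΦ.le⟩

end CompositeReg

end

theorem theorem1 {D g : ℕ} (τ : ℝ) (hτ : 0 < τ)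
    (G : Measure (CompositeReg.Cov D)) [IsProbabilityMeasure G]
    (Ω : Set (CompositeReg.Param D g)) (hΩ_open : IsOpen Ω)
    (hΩ : Ω ⊆ CompositeReg.naturalParams D g)
    (Φ₀ : CompositeReg.Param D g) (hΦ₀ : Φ₀ ∈ Ω)
    (hR : CompositeReg.RegularityConditions τ G Ω Φ₀)
    {S : Type*} [MeasurableSpace S] (P : Measure S) [IsProbabilityMeasure P]
    (V : ℕ → S → CompositeReg.Obs D) (hV : ∀ i, Measurable (V i))
    (hV_indep : iIndepFun V P)
    (hV_law : ∀ i, P.map (V i) = CompositeReg.modelLaw τ G Φ₀)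
    (pen : CompositeReg.Penalty D S) (hH : CompositeReg.PenaltyConditions P pen Φ₀) :
    ∃ Φhat : ℕ → S → CompositeReg.Param D g,
      Tendsto (fun n : ℕ => P {s | ¬ (Φhat n s ∈ Ω ∧
        IsLocalMax (CompositeReg.penLogLik τ V pen n s) (Φhat n s))}) atTop (𝓝 0) ∧
      ∀ ε : ENNReal, 0 < ε → ∃ M : ℝ, ∀ᶠ n : ℕ in atTop,
        P {s | M * (n : ℝ) ^ (-(1 / 2) : ℝ) < ‖Φhat n s - Φ₀‖} ≤ ε :=
  CompositeReg.exists_sqrt_consistent_selection Φ₀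
    (fun n s Φ => Φ ∈ Ω ∧ IsLocalMax (CompositeReg.penLogLik τ V pen n s) Φ) fun _ hε =>
      CompositeReg.exists_isLocalMax_penLogLik hΩ_open hΦ₀ hR hV hV_indep hV_law hH hε
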